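/- A left-order on a group $\Gamma$ is a left-invariant total order $\preceq$; it is Conradian (a $C$-order) if for all $f,g\succ id$ there is an integer $n\ge 1$ with $fg^n\succ g$, and $\Gamma$ is $C$-orderable if it admits a $C$-order. A rational series of length $k \geq 0$ for $\Gamma$ is a finite sequence of subgroups $$\{id\}=\Gamma^k\lhd\Gamma^{k-1}\lhd\cdots\lhd\Gamma^0=\Gamma,$$ each $\Gamma^i$ being normal in $\Gamma^{i-1}$ (but not necessarily in $\Gamma$), such that each quotient $\Gamma^{i-1}/\Gamma^i$, $1\le i\le k$, is a torsion-free Abelian group of rank $1$. The series is normal if every $\Gamma^i$ is normal in $\Gamma$. Theorem. If a $C$-orderable group $\Gamma$ has only finitely many $C$-orders, then it has a unique rational series $\{id\}=\Gamma^k\lhd\Gamma^{k-1}\lhd\cdots\lhd\Gamma^0=\Gamma$ (unique among rational series of all lengths); this series is normal, and no quotient $\Gamma^{i-2}/\Gamma^i$, $2\le i\le k$, is Abelian. Conversely, if $\Gamma$ is a group admitting a normal rational series $\{id\}=\Gamma^k\lhd\Gamma^{k-1}\lhd\cdots\lhd\Gamma^0=\Gamma$ such that no quotient $\Gamma^{i-2}/\Gamma^i$,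 $2\le i\le k$, is Abelian, then the number of $C$-orders on $\Gamma$ is exactly $2^k$. -/

import Mathlib

/-- A left-order on a group: a total order relation invariant under left multiplication. -/
@[ext]
structure LeftOrder (G : Type*) [Group G] where
  /-- the relation `a ≼ b` -/
  le : G → G → Prop
  le_refl : ∀ a, le a a
  le_trans : ∀ a b c, le a b → le b c → le a c
  le_antisymm : ∀ a b, le a b → le b a → a = b
  le_total : ∀ a b, le a b ∨ le b a
  mul_le_mul_left : ∀ f g h, le g h → le (f * g) (f * h)

namespace LeftOrder

variable {G : Type*} [Group G]

/-- The strict relation `a ≺ b`. -/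
def lt (o : LeftOrder G) (a b : G) : Prop :=
  o.le a b ∧ a ≠ b

/-- A left-order is Conradian if for all positive `f`, `g` there is a positive integer `n` with
`f gⁿ ≻ g`. -/
def IsConradian (o : LeftOrder G) : Prop :=
  ∀ f g : G, o.lt 1 f → o.lt 1 g → ∃ n : ℕ, 1 ≤ n ∧ o.lt g (f * g ^ n)

end LeftOrder

/-- The Conradian orders (`C`-orders) on a group. -/
def COrder (G : Type*) [Group G] : Type _ :=
  {o : LeftOrder G // o.IsConradian}

/-- A group is `C`-orderable if it admits a Conradian order. -/
def COrderable (G : Type*) [Group G] : Prop :=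
  Nonempty (COrder G)

/-- An abelian group is torsion-free of rank 1; the rank is the maximal number of
`ℤ`-linearly independent elements. -/
def IsTorsionFreeRankOne (A : Type*) [CommGroup A] : Prop :=
  IsMulTorsionFree A ∧ Module.rank ℤ (Additive A) = 1

/-- A group is torsion-free rank-1 abelian. -/
def IsTorsionFreeRankOneAbelian (Q : Type*) [inst : Group Q] : Prop :=
  ∃ hcomm : ∀ a b : Q, a * b = b * a,
    @IsTorsionFreeRankOne Q { inst with mul_comm := hcomm }

/-- A rational series of a group `G`: a finite subnormal sequence
`1 = Γᵏ ⊲ Γᵏ⁻¹ ⊲ ⋯ ⊲ Γ⁰ = G` whose successive quotients are torsion-free rank-1 abelian.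
The length `k` is part of the data. -/
structure RationalSeries (G : Type*) [Group G] where
  /-- the length `k` of the series -/
  length : ℕ
  /-- the subgroups `Γ⁰, …, Γᵏ` -/
  subgroup : Fin (length + 1) → Subgroup G
  subgroup_zero : subgroup 0 = ⊤
  subgroup_last : subgroup (Fin.last length) = ⊥
  succ_le : ∀ i : Fin length, subgroup i.succ ≤ subgroup i.castSucc
  succ_normal : ∀ i : Fin length,
    ((subgroup i.succ).subgroupOf (subgroup i.castSucc)).Normal
  quotient_rankOne : ∀ i : Fin length,
    IsTorsionFreeRankOneAbelian
      (subgroup i.castSucc ⧸ (subgroup i.succ).subgroupOf (subgroup i.castSucc))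

namespace RationalSeries

variable {G : Type*} [Group G]

/-- The series is normal: every term is normal in the whole group. -/
def IsNormal (s : RationalSeries G) : Prop :=
  ∀ i, (s.subgroup i).Normal

/-- No quotient `Γⁱ⁻² / Γⁱ`, `2 ≤ i ≤ k`, of a normal rational series is abelian. -/
def NoAbelianDoubleQuotient (s : RationalSeries G) (hs : s.IsNormal) : Prop :=
  ∀ i j : Fin (s.length + 1), (i : ℕ) + 2 = (j : ℕ) →
    haveI : (s.subgroup j).Normal := hs j
    ¬ ∀ a b : s.subgroup i ⧸ (s.subgroup j).subgroupOf (s.subgroup i), a * b = b * a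

end RationalSeries

/-! ### Left-ordered groups as linear orders -/

/-! From finiteness to a series. Reversing a Conradian order on a convex subgroup gives another
Conradian order (`LeftOrder.IsConvex.isConradian_flip`), and distinct convex subgroups give distinct
reversals, so finitely many `C`-orders leave finitely many convex subgroups. A nontrivial group then
has a largest proper convex subgroup. Conrad's argument makes it normal with Archimedean quotient,
and Hölder makes that quotient abelian; it is also torsion-free. Hence for H nontrivial with
finitely many `C`-orders (and at least one), the isolator I of [H, H] in H is proper. Lexicographic
orders embed pairs (order on I, order on H/I) into the `C`-orders of H. So H/I has finitely many
orders, which forces rank one and therefore exactly two orders, and I has at most half as many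
`C`-orders as H. Iterating the isolator thus reaches the trivial group, through normal subgroups.

Uniqueness: if H/N is torsion-free abelian of rank one, then N contains I, and N cannot be larger
because H/I already has rank one. If a double quotient were abelian, the middle term, being the
isolator of the commutator subgroup of the upper one, would lie in the lower one.

Converse. Working up from the bottom of the series,
`LeftOrder.IsConradian.isConvex_of_isRankOneSection` shows that each term is convex in the preceding
one for every `C`-order. Every `C`-order is then lexicographic, so each rank-one step doubles the
count. -/

section LinearOrder

variable {G : Type*} [Group G] [LinearOrder G]

/-- The Conrad property of a linearly ordered group. -/
def ConradProperty (G : Type*) [Group G] [LinearOrder G] : Prop :=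
  ∀ f g : G, 1 < f → 1 < g → ∃ n : ℕ, 1 ≤ n ∧ g < f * g ^ n

/-- A subgroup is convex if it contains every element between `1` and one of its elements. -/
def IsConvexSubgroup (C : Subgroup G) : Prop :=
  ∀ x y : G, 1 ≤ x → x ≤ y → y ∈ C → x ∈ C

theorem IsConvexSubgroup.lt_of_notMem {C : Subgroup G} (hC : IsConvexSubgroup C)
    {c x : G} (hc : c ∈ C) (hx : x ∉ C) (h1 : 1 < x) : c < x := by
  by_contra! h
  exact hx (hC x c h1.le h hc)

variable [MulLeftMono G]

/-! ### Uniform exponents in the Conrad condition, and the convex hull of an element -/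

namespace ConradProperty

/-- If `f * g ^ 2 ≤ g`, then left multiplication by `f * g` keeps `g` from growing, so `f * (f * g)
^ n ≤ f * g` for all `n`, against the Conrad property for `f` and `f * g`. An exponent independent
of `f` and `g` is what passes to quotients and extensions. -/
theorem lt_mul_sq (hC : ConradProperty G) {f g : G} (hf : 1 < f) (hg : 1 < g) :
    g < f * g ^ 2 := by
  by_contra! hlt
  have hfg : 1 < f * g := one_lt_mul'' hf hg
  have h1 : f * g * g ≤ g := by rwa [mul_assoc, ← pow_two]
  have h2 : ∀ n : ℕ, (f * g) ^ n * g ≤ g := by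
    intro n
    induction n with
    | zero => simp
    | succ n ih =>
      rw [pow_succ, mul_assoc]
      exact (mul_le_mul_right h1 _).trans ih
  obtain ⟨n, -, hn⟩ := hC f (f * g) hf hfg
  refine absurd hn (not_lt.2 (mul_le_mul_right ?_ _))
  exact (le_mul_of_one_le_right' hg.le).trans (h2 n)

/-- Counterpart for negative elements, needed when an order is reversed. If it fails, `A = g⁻¹ * f *
g ^ 2` and `B = g⁻¹ * f * g` are positive, yet `A * B ^ n = B * (f ^ n * g) ≤ B` for every `n`. -/
theorem mul_cube_lt (hC : ConradProperty G) {f g : G} (hf : f < 1) (hg : g < 1) :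
    f * g ^ 3 < g := by
  by_contra! hle
  have hg2 : g ^ 2 < 1 := by rw [pow_two]; exact (mul_lt_of_lt_one_right' g hg).trans hg
  have h3 : g ^ 3 < g := by
    rw [pow_succ']; exact mul_lt_of_lt_one_right' g hg2
  have h3' : g ^ 3 < g ^ 2 := by
    rw [pow_succ]; exact mul_lt_of_lt_one_right' _ hg
  have hA : 1 < g⁻¹ * (f * g ^ 2) := by
    rw [lt_inv_mul_iff_mul_lt, mul_one]; exact hle.trans_lt (mul_lt_mul_right h3' f)
  have hB : 1 < g⁻¹ * (f * g) := by
    rw [lt_inv_mul_iff_mul_lt, mul_one]; exact hle.trans_lt (mul_lt_mul_right h3 f)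
  obtain ⟨n, -, hn⟩ := hC _ _ hA hB
  have hpow : (g⁻¹ * (f * g)) ^ n = g⁻¹ * f ^ n * g := by
    have := conj_pow (i := n) (a := g⁻¹) (b := f)
    simpa [mul_assoc] using this
  have h4 : g⁻¹ * (f * g ^ 2) * (g⁻¹ * (f * g)) ^ n = g⁻¹ * (f * g) * (f ^ n * g) := by
    rw [hpow]; group
  have h5 : f ^ n * g < 1 := (mul_lt_of_lt_one_right' _ hg).trans_le (pow_le_one' hf.le n)
  rw [h4] at hn
  exact absurd hn (not_lt.2 (mul_le_of_le_one_right' h5.le))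

/-- This gives closure of `powHull` under products. If `h * g ^ N` exceeded every power of `g`, the
Conrad property would fail for the pair `h⁻¹ * g ^ N`, `g ^ N`. -/
theorem exists_mul_pow_le (hC : ConradProperty G) {g h : G} (hg : 1 < g) {N : ℕ}
    (hh : h ≤ g ^ N) : ∃ M : ℕ, h * g ^ N ≤ g ^ M := by
  by_contra! hM
  rcases hh.eq_or_lt with rfl | hlt
  · exact absurd (hM (N + N)) (by rw [pow_add]; exact lt_irrefl _)
  have hN : N ≠ 0 := by
    rintro rfl
    exact absurd (hM 0) (by simpa using hh)
  have hk : 1 < g ^ N := one_lt_pow' hg hN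
  have ha : 1 < h⁻¹ * g ^ N := by rwa [lt_inv_mul_iff_mul_lt, mul_one]
  obtain ⟨m, -, hm⟩ := hC _ _ ha hk
  refine absurd hm (not_lt.2 ?_)
  rw [mul_assoc, ← pow_succ', inv_mul_le_iff_le_mul, ← pow_mul]
  exact (hM _).le

/-- The convex subgroup generated by a positive element. -/
def powHull (hC : ConradProperty G) {g : G} (hg : 1 < g) : Subgroup G where
  carrier := {h | ∃ n : ℕ, h ≤ g ^ n ∧ h⁻¹ ≤ g ^ n}
  one_mem' := ⟨0, by simp⟩
  inv_mem' := by
    rintro x ⟨n, h1, h2⟩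
    exact ⟨n, h2, by simpa using h1⟩
  mul_mem' := by
    have key : ∀ (a b : G) (m n : ℕ), a ≤ g ^ m → b ≤ g ^ n → ∃ M : ℕ, a * b ≤ g ^ M := by
      intro a b m n ha hb
      have ha' : a ≤ g ^ (m + n) := ha.trans (pow_le_pow_right' hg.le (by omega))
      have hb' : b ≤ g ^ (m + n) := hb.trans (pow_le_pow_right' hg.le (by omega))
      obtain ⟨M, hM⟩ := hC.exists_mul_pow_le hg ha'
      exact ⟨M, (mul_le_mul_right hb' a).trans hM⟩
    rintro a b ⟨m, ha, ha'⟩ ⟨n, hb, hb'⟩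
    obtain ⟨M, hM⟩ := key a b m n ha hb
    obtain ⟨M', hM'⟩ := key b⁻¹ a⁻¹ n m hb' ha'
    refine ⟨M + M', hM.trans (pow_le_pow_right' hg.le (by omega)), ?_⟩
    rw [mul_inv_rev]
    exact hM'.trans (pow_le_pow_right' hg.le (by omega))

theorem isConvexSubgroup_powHull (hC : ConradProperty G) {g : G} (hg : 1 < g) :
    IsConvexSubgroup (hC.powHull hg) := by
  rintro x y hx hxy ⟨n, h1, -⟩
  exact ⟨n, hxy.trans h1, (inv_le_one'.2 hx).trans (one_le_pow_of_one_le' hg.le n)⟩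

end ConradProperty

/-! ### Convex subgroups: nesting and normality -/

namespace IsConvexSubgroup

theorem mem_of_le_of_le {C : Subgroup G} (hC : IsConvexSubgroup C) {c x d : G} (hc : c ∈ C)
    (hd : d ∈ C) (h1 : c ≤ x) (h2 : x ≤ d) : x ∈ C := by
  have h3 : c⁻¹ * x ∈ C := hC _ (c⁻¹ * d) (by rwa [le_inv_mul_iff_mul_le, mul_one])
    (mul_le_mul_right h2 _) (mul_mem (inv_mem hc) hd)
  simpa using mul_mem hc h3

/-- Otherwise an element of C outside D and one of D outside C, replaced by their absolute values,
would each be smaller than the other. -/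
theorem le_total {C D : Subgroup G} (hC : IsConvexSubgroup C) (hD : IsConvexSubgroup D) :
    C ≤ D ∨ D ≤ C := by
  by_contra! h
  obtain ⟨⟨c, hcC, hcD⟩, ⟨d, hdD, hdC⟩⟩ := And.imp SetLike.not_le_iff_exists.1
    SetLike.not_le_iff_exists.1 h
  have pos : ∀ (E : Subgroup G) (e : G), e ∉ E → 1 < |e|ₘ ∧ |e|ₘ ∉ E := by
    intro E e he
    have hne : e ≠ 1 := fun h => he (h ▸ one_mem E)
    rcases lt_or_gt_of_ne hne with h | h
    · rw [mabs_of_lt_one h]; exact ⟨one_lt_inv'.2 h, by simpa⟩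
    · rw [mabs_of_one_lt h]; exact ⟨h, he⟩
  have mem : ∀ (E : Subgroup G) (e : G), e ∈ E → |e|ₘ ∈ E := by
    intro E e he
    rcases mabs_choice e with h | h <;> rw [h]
    · exact he
    · exact inv_mem he
  obtain ⟨hc1, hc2⟩ := pos D c hcD
  obtain ⟨hd1, hd2⟩ := pos C d hdC
  exact lt_asymm (hC.lt_of_notMem (mem C c hcC) hd2 hd1) (hD.lt_of_notMem (mem D d hdD) hc2 hc1)

/-- Conrad: if the powers of every positive element outside a convex subgroup are cofinal, then
the subgroup is normal. -/
theorem normal_of_cofinal (hG : ConradProperty G) {C : Subgroup G} (hC : IsConvexSubgroup C)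
    (hcof : ∀ g : G, g ∉ C → 1 < g → ∀ x : G, ∃ n : ℕ, x ≤ g ^ n) : C.Normal := by
  have key : ∀ c ∈ C, ∀ h : G, 1 < h * c * h⁻¹ → h * c * h⁻¹ ∈ C := by
    intro c hc h hw
    by_contra hwC
    have hh : h ∉ C := fun hh => hwC (mul_mem (mul_mem hh hc) (inv_mem hh))
    -- Powers of the conjugate are `h * c ^ n * h⁻¹`; cancelling `h` on the left makes the elements
    -- `c ^ n * h⁻¹` cofinal.
    have hcof' : ∀ y : G, ∃ n : ℕ, y ≤ c ^ n * h⁻¹ := by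
      intro y
      obtain ⟨n, hn⟩ := hcof _ hwC hw (h * y)
      refine ⟨n, ?_⟩
      rw [conj_pow, mul_assoc] at hn
      exact le_of_mul_le_mul_left' hn
    have hne : h⁻¹ ≠ 1 := fun h1 => hh (by rw [inv_eq_one.1 h1]; exact one_mem C)
    rcases lt_or_gt_of_ne hne with h1 | h1
    · obtain ⟨n, hn⟩ := hcof' 1
      have h2 : c ^ (-n : ℤ) ≤ h⁻¹ := by
        rw [zpow_neg, zpow_natCast, inv_le_iff_one_le_mul']; exact hn
      refine hh (inv_mem_iff.1 (hC.mem_of_le_of_le (zpow_mem hc _) (one_mem C) h2 h1.le))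
    -- The cube is chosen because `lt_mul_sq`, applied to `(c ^ n)⁻¹ * h⁻¹` and `h⁻¹`, gives `c ^ n
    -- * h⁻¹ < h⁻¹ ^ 3`.
    · obtain ⟨n, hn⟩ := hcof' (h⁻¹ ^ 3)
      have hcn : c ^ n ∈ C := pow_mem hc n
      have h2 : 1 < (c ^ n)⁻¹ * h⁻¹ := by
        rw [lt_inv_mul_iff_mul_lt, mul_one]
        exact hC.lt_of_notMem hcn (by simpa using hh) h1
      have h3 := hG.lt_mul_sq h2 h1
      rw [mul_assoc, ← pow_succ', lt_inv_mul_iff_mul_lt] at h3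
      exact absurd h3 (not_lt.2 hn)
  refine ⟨fun c hc h => ?_⟩
  rcases lt_trichotomy 1 (h * c * h⁻¹) with h1 | h1 | h1
  · exact key c hc h h1
  · rw [← h1]; exact one_mem C
  · have h2 := key c⁻¹ (inv_mem hc) h (by simpa [mul_assoc] using one_lt_inv'.2 h1)
    simpa [mul_assoc] using inv_mem h2

end IsConvexSubgroup

/-- Hölder: an Archimedean left-ordered group is commutative. -/
theorem mul_comm_of_archimedean (h : ∀ g : G, 1 < g → ∀ x : G, ∃ n : ℕ, x ≤ g ^ n) (a b : G) :
    a * b = b * a := by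
  have conj_pos : ∀ f k : G, 1 < f → 1 < k⁻¹ * f * k := by
    intro f k hf
    by_contra! hle
    have hne : k⁻¹ * f * k ≠ 1 := by
      intro h1
      have : f = 1 := by
        have := congrArg (fun z => k * z * k⁻¹) h1
        simpa [mul_assoc] using this
      exact hf.ne' this
    have hlt := lt_of_le_of_ne hle hne
    have hw : 1 < (k⁻¹ * f * k)⁻¹ := one_lt_inv'.2 hlt
    have hwn : ∀ n : ℕ, (k⁻¹ * f * k) ^ n = k⁻¹ * f ^ n * k := fun n => by
      simpa using conj_pow (i := n) (a := k⁻¹) (b := f)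
    rcases le_or_gt k 1 with hk | hk
    · obtain ⟨n, hn⟩ := h _ hw (k⁻¹ * f)
      rw [inv_pow, hwn, mul_inv_rev, mul_inv_rev, inv_inv] at hn
      have h1 : f ≤ (f ^ n)⁻¹ * k := le_of_mul_le_mul_left' hn
      have h2 : (f ^ n)⁻¹ * k ≤ 1 :=
        (mul_le_of_le_one_right' hk).trans (inv_le_one'.2 (one_le_pow_of_one_le' hf.le n))
      exact absurd hf (not_lt.2 (h1.trans h2))
    · obtain ⟨n, hn⟩ := h _ hf k
      have h1 : k⁻¹ * f ^ n * k ≤ 1 := by rw [← hwn]; exact pow_le_one' hlt.le n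
      rw [mul_assoc, inv_mul_le_iff_le_mul, mul_one] at h1
      exact absurd (lt_mul_of_one_lt_right' (f ^ n) hk) (not_lt.2 (h1.trans hn))
  -- Positivity is conjugation-invariant, so the order is bi-invariant.
  have : MulRightMono G := ⟨fun k x y hxy => by
    change x * k ≤ y * k
    rcases hxy.eq_or_lt with rfl | hlt
    · exact le_rfl
    have h1 : 1 < x⁻¹ * y := by rwa [lt_inv_mul_iff_mul_lt, mul_one]
    have h2 := conj_pos _ k h1
    rw [mul_assoc, lt_inv_mul_iff_mul_lt, mul_one, mul_assoc, lt_inv_mul_iff_mul_lt] at h2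
    exact h2.le⟩
  have key : ∀ f g : G, 1 < f → 1 < g → f * g ≤ g * f := by
    intro f g hf hg
    by_contra! hlt
    set c := f * g * (g * f)⁻¹ with hc
    have hc1 : 1 < c := by rwa [hc, lt_mul_inv_iff_mul_lt, one_mul]
    have between : ∀ a x : G, 1 < a → 1 < x → ∃ m : ℕ, a ^ m ≤ x ∧ x < a ^ (m + 1) := by
      intro a x ha hx
      classical
      have hex : ∃ n : ℕ, x < a ^ n := by
        obtain ⟨n, hn⟩ := h a ha x
        exact ⟨n + 1, hn.trans_lt (by rw [pow_succ]; exact lt_mul_of_one_lt_right' _ ha)⟩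
      have h0 : Nat.find hex ≠ 0 := by
        intro h0
        have := Nat.find_spec hex
        rw [h0, pow_zero] at this
        exact lt_asymm this hx
      refine ⟨Nat.find hex - 1, ?_, ?_⟩
      · exact not_lt.1 (Nat.find_min hex (by omega))
      · rw [Nat.sub_add_cancel (by omega)]; exact Nat.find_spec hex
    -- Hölder's dichotomy for the commutator `c`. If some `a` satisfies `a ^ 2 ≤ c`, locating `f`
    -- and `g` between consecutive powers of `a` bounds the error in commuting them by less than `a
    -- ^ 2`. Otherwise `c` is the least positive element and every positive element is a power of
    -- it.
    by_cases hsq : ∃ a : G, 1 < a ∧ a ^ 2 ≤ c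
    · obtain ⟨a, ha, hac⟩ := hsq
      obtain ⟨m, hm, hm'⟩ := between a f ha hf
      obtain ⟨n, hn, hn'⟩ := between a g ha hg
      have h1 : f * g < a ^ (m + 1) * a ^ (n + 1) := mul_lt_mul_of_lt_of_lt hm' hn'
      have h2 : a ^ n * a ^ m ≤ g * f := mul_le_mul' hn hm
      have h3 : c * (g * f) = f * g := by rw [hc]; group
      have h4 : a ^ 2 * (a ^ n * a ^ m) ≤ f * g := by rw [← h3]; exact mul_le_mul' hac h2
      have h5 : a ^ 2 * (a ^ n * a ^ m) = a ^ (m + 1) * a ^ (n + 1) := by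
        simp only [← pow_add]; congr 1; omega
      exact absurd h1 (not_lt.2 (h5 ▸ h4))
    · push Not at hsq
      have hmin : ∀ a : G, 1 < a → c ≤ a := by
        intro a ha
        by_contra! hac
        have hd : 1 < a⁻¹ * c := by rwa [lt_inv_mul_iff_mul_lt, mul_one]
        refine absurd (hsq _ hd) (not_lt.2 ?_)
        have h1 : c * a⁻¹ ≤ a := by
          rw [mul_inv_le_iff_le_mul, ← pow_two]; exact (hsq a ha).le
        have h2 : a⁻¹ * (c * a⁻¹) ≤ 1 := by rwa [inv_mul_le_iff_le_mul, mul_one]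
        calc (a⁻¹ * c) ^ 2 = a⁻¹ * (c * a⁻¹) * c := by rw [pow_two]; group
          _ ≤ 1 * c := mul_le_mul_left h2 c
          _ = c := one_mul c
      have hpow : ∀ x : G, 1 < x → ∃ m : ℕ, x = c ^ m := by
        intro x hx
        obtain ⟨m, hm, hm'⟩ := between c x hc1 hx
        refine ⟨m, ?_⟩
        by_contra hne
        have h1 : 1 < (c ^ m)⁻¹ * x := by
          rw [lt_inv_mul_iff_mul_lt, mul_one]; exact lt_of_le_of_ne hm (Ne.symm hne)
        have h2 := hmin _ h1
        rw [le_inv_mul_iff_mul_le, ← pow_succ] at h2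
        exact absurd hm' (not_lt.2 h2)
      obtain ⟨m, hm⟩ := hpow f hf
      obtain ⟨n, hn⟩ := hpow g hg
      rw [hm, hn, ← pow_add, ← pow_add, add_comm] at hlt
      exact lt_irrefl _ hlt
  have key' : ∀ f g : G, 1 < f → 1 < g → Commute f g := fun f g hf hg =>
    le_antisymm (key f g hf hg) (key g f hg hf)
  have key'' : ∀ f g : G, 1 < f → Commute f g := by
    intro f g hf
    rcases lt_trichotomy 1 g with hg | hg | hg
    · exact key' f g hf hg
    · rw [← hg]; exact Commute.one_right f
    · exact Commute.inv_right_iff.1 (key' f g⁻¹ hf (one_lt_inv'.2 hg))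
  rcases lt_trichotomy 1 a with ha | ha | ha
  · exact key'' a b ha
  · rw [← ha]; simp
  · exact Commute.inv_left_iff.1 (key'' a⁻¹ b (one_lt_inv'.2 ha))

end LinearOrder

/-! ### Left-orders and positive cones -/

namespace LeftOrder

variable {G : Type*} [Group G]

/-- The cone of elements `≽ 1`. -/
def cone (o : LeftOrder G) : Set G := {g | o.le 1 g}

theorem le_iff_mem_cone (o : LeftOrder G) (a b : G) : o.le a b ↔ a⁻¹ * b ∈ o.cone := by
  constructor
  · intro h
    simpa [cone] using o.mul_le_mul_left a⁻¹ a b h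
  · intro h
    simpa using o.mul_le_mul_left a 1 (a⁻¹ * b) h

theorem one_mem_cone (o : LeftOrder G) : (1 : G) ∈ o.cone := o.le_refl 1

theorem mul_mem_cone (o : LeftOrder G) {a b : G} (ha : a ∈ o.cone) (hb : b ∈ o.cone) :
    a * b ∈ o.cone :=
  o.le_trans 1 a (a * b) ha (by simpa using o.mul_le_mul_left a 1 b hb)

theorem eq_one_of_mem_cone (o : LeftOrder G) {a : G} (ha : a ∈ o.cone) (ha' : a⁻¹ ∈ o.cone) :
    a = 1 :=
  o.le_antisymm _ _ ((o.le_iff_mem_cone _ _).2 (by simpa using ha')) ha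

theorem mem_cone_or (o : LeftOrder G) (a : G) : a ∈ o.cone ∨ a⁻¹ ∈ o.cone := by
  rcases o.le_total 1 a with h | h
  · exact Or.inl h
  · exact Or.inr (by simpa using (o.le_iff_mem_cone _ _).1 h)

theorem pow_mem_cone (o : LeftOrder G) {a : G} (ha : a ∈ o.cone) (n : ℕ) : a ^ n ∈ o.cone := by
  induction n with
  | zero => simpa using o.one_mem_cone
  | succ n ih => rw [pow_succ]; exact o.mul_mem_cone ih ha

theorem eq_one_of_mul_eq_one (o : LeftOrder G) {a b : G} (ha : a ∈ o.cone) (hb : b ∈ o.cone)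
    (h : a * b = 1) : a = 1 :=
  o.eq_one_of_mem_cone ha (by rwa [inv_eq_of_mul_eq_one_right h])

theorem eq_of_cone_subset {o o' : LeftOrder G} (h : o.cone ⊆ o'.cone) : o = o' := by
  have key : o.cone = o'.cone := by
    refine h.antisymm fun x hx => ?_
    rcases o.mem_cone_or x with h1 | h1
    · exact h1
    · rw [o'.eq_one_of_mem_cone hx (h h1)]
      exact o.one_mem_cone
  ext a b
  rw [le_iff_mem_cone, le_iff_mem_cone, key]

/-- The left-order with a given positive cone. -/
def ofCone (P : Set G) (h1 : 1 ∈ P) (hmul : ∀ a ∈ P, ∀ b ∈ P, a * b ∈ P)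
    (hanti : ∀ a ∈ P, a⁻¹ ∈ P → a = 1) (htot : ∀ a, a ∈ P ∨ a⁻¹ ∈ P) : LeftOrder G where
  le a b := a⁻¹ * b ∈ P
  le_refl a := by simpa using h1
  le_trans a b c h h' := by simpa [mul_assoc] using hmul _ h _ h'
  le_antisymm a b h h' := by
    have := hanti _ h (by simpa using h')
    rw [inv_mul_eq_one] at this
    exact this
  le_total a b := by simpa using htot (a⁻¹ * b)
  mul_le_mul_left f g h hgh := by simpa [mul_assoc] using hgh

theorem cone_ofCone (P : Set G) (h1 hmul hanti htot) :
    (ofCone (G := G) P h1 hmul hanti htot).cone = P := by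
  ext x; simp [cone, ofCone]

/-- The linear order underlying a left-order. -/
noncomputable abbrev linearOrder (o : LeftOrder G) : LinearOrder G where
  le := o.le
  le_refl := o.le_refl
  le_trans := o.le_trans
  le_antisymm := o.le_antisymm
  le_total := o.le_total
  toDecidableLE := Classical.decRel _

theorem mulLeftMono (o : LeftOrder G) : letI := o.linearOrder; MulLeftMono G :=
  let _ := o.linearOrder
  ⟨fun f g h hgh => o.mul_le_mul_left f g h hgh⟩

theorem lt_iff (o : LeftOrder G) (a b : G) : o.lt a b ↔ letI := o.linearOrder; a < b := by
  let _ := o.linearOrder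
  exact (lt_iff_le_and_ne (a := a) (b := b)).symm

theorem isConradian_iff_conradProperty (o : LeftOrder G) :
    o.IsConradian ↔ letI := o.linearOrder; ConradProperty G := by
  simp only [IsConradian, ConradProperty, lt_iff]

/-- The hypothesis is weaker in two ways: it allows equality and `n = 0`. One more factor `g`
repairs both. -/
theorem isConradian_of_cone (o : LeftOrder G)
    (h : ∀ f ∈ o.cone, ∀ g ∈ o.cone, f ≠ 1 → g ≠ 1 → ∃ n : ℕ, g⁻¹ * f * g ^ n ∈ o.cone) :
    o.IsConradian := by
  rintro f g ⟨hf, hf1⟩ ⟨hg, hg1⟩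
  obtain ⟨n, hn⟩ := h f hf g hg hf1.symm hg1.symm
  refine ⟨n + 1, by omega, (o.le_iff_mem_cone _ _).2 ?_, fun heq => hg1 ?_⟩
  · rw [pow_succ, ← mul_assoc, ← mul_assoc]
    exact o.mul_mem_cone hn hg
  · refine (o.eq_one_of_mem_cone hg ?_).symm
    have : g⁻¹ = g⁻¹ * f * g ^ n := by
      rw [eq_comm, ← mul_eq_one_iff_eq_inv, mul_assoc, mul_assoc, ← pow_succ, ← heq,
        inv_mul_cancel]
    rwa [this]

/-- The weak form of `lt_mul_sq`: it includes trivial `f` or `g`, so it can be applied to images in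
a quotient. -/
theorem IsConradian.conj_sq_mem {o : LeftOrder G} (ho : o.IsConradian) {f g : G}
    (hf : f ∈ o.cone) (hg : g ∈ o.cone) : g⁻¹ * f * g ^ 2 ∈ o.cone := by
  let _ := o.linearOrder
  have := o.mulLeftMono
  by_cases hf1 : f = 1
  · subst hf1; simpa [pow_two] using hg
  by_cases hg1 : g = 1
  · subst hg1; simpa using hf
  have := (o.isConradian_iff_conradProperty.1 ho).lt_mul_sq (lt_of_le_of_ne' (show 1 ≤ f from hf) hf1)
    (lt_of_le_of_ne' (show 1 ≤ g from hg) hg1)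
  rw [mul_assoc]
  exact (o.le_iff_mem_cone _ _).1 this.le

theorem IsConradian.conj_cube_mem {o : LeftOrder G} (ho : o.IsConradian) {f g : G}
    (hf : f⁻¹ ∈ o.cone) (hg : g⁻¹ ∈ o.cone) : (g⁻¹ * f * g ^ 3)⁻¹ ∈ o.cone := by
  let _ := o.linearOrder
  have := o.mulLeftMono
  by_cases hf1 : f = 1
  · subst hf1
    have := o.pow_mem_cone hg 2
    rw [inv_pow] at this
    convert this using 1
    group
  by_cases hg1 : g = 1
  · subst hg1; simpa using hf
  have h1 : ∀ x : G, x⁻¹ ∈ o.cone → x ≠ 1 → x < 1 := fun x hx hx1 =>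
    lt_of_le_of_ne ((o.le_iff_mem_cone _ _).2 (by simpa using hx)) hx1
  have := (o.isConradian_iff_conradProperty.1 ho).mul_cube_lt (h1 f hf hf1) (h1 g hg hg1)
  have := (o.le_iff_mem_cone _ _).1 this.le
  simpa [mul_assoc] using this

theorem isConradian_of_comm (o : LeftOrder G) (h : ∀ a b : G, a * b = b * a) :
    o.IsConradian :=
  o.isConradian_of_cone fun f hf g _ _ _ => ⟨1, by rwa [pow_one, mul_assoc, h f g, inv_mul_cancel_left]⟩

/-- Convexity of a subgroup with respect to a left-order. -/
def IsConvex (o : LeftOrder G) (C : Subgroup G) : Prop :=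
  ∀ x y : G, o.le 1 x → o.le x y → y ∈ C → x ∈ C

/-- The pull-back of a left-order under an injective homomorphism. -/
def comap {H : Type*} [Group H] (o : LeftOrder G) (i : H →* G) (hi : Function.Injective i) :
    LeftOrder H :=
  ofCone (i ⁻¹' o.cone) (by simpa using o.one_mem_cone)
    (fun a ha b hb => by simpa using o.mul_mem_cone ha hb)
    (fun a ha ha' => (map_eq_one_iff i hi).1 (o.eq_one_of_mem_cone ha (by simpa using ha')))
    (fun a => by simpa using o.mem_cone_or (i a))

theorem mem_cone_comap {H : Type*} [Group H] {o : LeftOrder G} {i : H →* G}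
    {hi : Function.Injective i} {x : H} : x ∈ (o.comap i hi).cone ↔ i x ∈ o.cone := by
  rw [comap, cone_ofCone]; rfl

theorem IsConradian.comap {H : Type*} [Group H] {o : LeftOrder G} (ho : o.IsConradian)
    (i : H →* G) (hi : Function.Injective i) : (o.comap i hi).IsConradian :=
  isConradian_of_cone _ fun f hf g hg _ _ => ⟨2, by
    rw [mem_cone_comap] at *; simpa using ho.conj_sq_mem hf hg⟩

/-- The push-forward of a left-order under a surjective homomorphism with convex kernel. -/
def map {Q : Type*} [Group Q] (o : LeftOrder G) (p : G →* Q) (hp : Function.Surjective p)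
    (hk : o.IsConvex p.ker) : LeftOrder Q :=
  ofCone (p '' o.cone) ⟨1, o.one_mem_cone, map_one p⟩
    (by
      rintro _ ⟨a, ha, rfl⟩ _ ⟨b, hb, rfl⟩
      exact ⟨a * b, o.mul_mem_cone ha hb, map_mul p a b⟩)
    (by
      rintro _ ⟨a, ha, rfl⟩ ⟨b, hb, hab⟩
      -- Antisymmetry is where convexity enters: `a` lies between `1` and the kernel element `a *
      -- b`.
      refine hk a (a * b) ha ?_ ?_
      · rw [le_iff_mem_cone]; simpa using hb
      · rw [MonoidHom.mem_ker, map_mul, hab, mul_inv_cancel])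
    (by
      intro a
      obtain ⟨x, rfl⟩ := hp a
      rcases o.mem_cone_or x with h | h
      · exact Or.inl ⟨x, h, rfl⟩
      · exact Or.inr ⟨x⁻¹, h, map_inv p x⟩)

theorem cone_map {Q : Type*} [Group Q] (o : LeftOrder G) (p : G →* Q)
    (hp : Function.Surjective p) (hk : o.IsConvex p.ker) : (o.map p hp hk).cone = p '' o.cone :=
  cone_ofCone ..

/-! ### Reversing an order on a convex subgroup -/

namespace IsConvex

variable {o : LeftOrder G} {C : Subgroup G}

theorem mem_of_le_of_le (hC : o.IsConvex C) {c x d : G} (hc : c ∈ C) (hd : d ∈ C)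
    (h1 : o.le c x) (h2 : o.le x d) : x ∈ C :=
  let _ := o.linearOrder
  have := o.mulLeftMono
  IsConvexSubgroup.mem_of_le_of_le (C := C) hC hc hd h1 h2

theorem mul_mem_cone_right (hC : o.IsConvex C) {g c : G} (hg : g ∈ o.cone) (hgC : g ∉ C)
    (hc : c ∈ C) : g * c ∈ o.cone ∧ g * c ∉ C := by
  refine ⟨(o.mem_cone_or _).resolve_right fun h => hgC ?_, fun h => hgC ?_⟩
  · refine inv_mem_iff.1 (hC.mem_of_le_of_le hc (one_mem C) ?_ ?_)
    · rw [le_iff_mem_cone]; simpa using h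
    · rw [le_iff_mem_cone]; simpa using hg
  · simpa using mul_mem h (inv_mem hc)

theorem mul_mem_cone_left (hC : o.IsConvex C) {g c : G} (hg : g ∈ o.cone) (hgC : g ∉ C)
    (hc : c ∈ C) : c * g ∈ o.cone ∧ c * g ∉ C := by
  refine ⟨(o.mem_cone_or _).resolve_right fun h => hgC ?_, fun h => hgC ?_⟩
  · refine hC g c⁻¹ hg ?_ (inv_mem hc)
    rw [le_iff_mem_cone]; simpa using h
  · simpa using mul_mem (inv_mem hc) h

theorem mul_mem_cone (hC : o.IsConvex C) {g h : G} (hg : g ∈ o.cone) (hgC : g ∉ C)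
    (hh : h ∈ o.cone) : g * h ∈ o.cone ∧ g * h ∉ C :=
  ⟨o.mul_mem_cone hg hh, fun hmem => hgC (hC g (g * h) hg
    ((o.le_iff_mem_cone _ _).2 (by simpa using hh)) hmem)⟩

/-- The order obtained by reversing the order on a convex subgroup. -/
def flip (hC : o.IsConvex C) : LeftOrder G :=
  ofCone {g | (g ∉ C ∧ g ∈ o.cone) ∨ (g ∈ C ∧ g⁻¹ ∈ o.cone)}
    (Or.inr ⟨one_mem C, by simpa using o.one_mem_cone⟩)
    (by
      rintro a (⟨haC, ha⟩ | ⟨haC, ha⟩) b (⟨hbC, hb⟩ | ⟨hbC, hb⟩)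
      · exact Or.inl (hC.mul_mem_cone ha haC hb).symm
      · exact Or.inl (hC.mul_mem_cone_right ha haC hbC).symm
      · exact Or.inl (hC.mul_mem_cone_left hb hbC haC).symm
      · exact Or.inr ⟨mul_mem haC hbC, by rw [mul_inv_rev]; exact o.mul_mem_cone hb ha⟩)
    (by
      rintro a (⟨haC, ha⟩ | ⟨haC, ha⟩) (⟨haC', ha'⟩ | ⟨haC', ha'⟩)
      · exact o.eq_one_of_mem_cone ha ha'
      · exact absurd (inv_mem_iff.1 haC') haC
      · exact absurd (inv_mem haC) haC'
      · exact o.eq_one_of_mem_cone (by simpa using ha') ha)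
    (by
      intro a
      by_cases haC : a ∈ C
      · rcases o.mem_cone_or a with h | h
        · exact Or.inr (Or.inr ⟨inv_mem haC, by simpa using h⟩)
        · exact Or.inl (Or.inr ⟨haC, h⟩)
      · rcases o.mem_cone_or a with h | h
        · exact Or.inl (Or.inl ⟨haC, h⟩)
        · exact Or.inr (Or.inl ⟨by simpa using haC, h⟩))

theorem mem_cone_flip (hC : o.IsConvex C) {g : G} :
    g ∈ hC.flip.cone ↔ (g ∉ C ∧ g ∈ o.cone) ∨ (g ∈ C ∧ g⁻¹ ∈ o.cone) := by
  rw [flip, cone_ofCone]; rfl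

/-- If `g` lies outside C, then `f * g` is positive for the old order whichever sign `f` has, and
`conj_sq_mem` applies to it; a fourth factor `g` is used when the result falls into C, where signs
are reversed. If only `f` is outside, multiplication by C does not change its sign. If both are in
C, the reversed inequality is `conj_cube_mem`. -/
theorem isConradian_flip (hC : o.IsConvex C) (ho : o.IsConradian) :
    hC.flip.IsConradian := by
  refine isConradian_of_cone _ fun f hf g hg _ _ => ?_
  simp only [mem_cone_flip] at hf hg ⊢
  rcases hg with ⟨hgC, hg⟩ | ⟨hgC, hg⟩
  · have hfg : f * g ∈ o.cone := by
      rcases hf with ⟨hfC, hf⟩ | ⟨hfC, hf⟩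
      · exact o.mul_mem_cone hf hg
      · exact (hC.mul_mem_cone_left hg hgC hfC).1
    have hw := ho.conj_sq_mem hfg hg
    have h3 : g⁻¹ * (f * g) * g ^ 2 = g⁻¹ * f * g ^ 3 := by group
    rw [h3] at hw
    by_cases hwC : g⁻¹ * f * g ^ 3 ∈ C
    · refine ⟨4, Or.inl ?_⟩
      rw [pow_succ _ 3, ← mul_assoc]
      exact (hC.mul_mem_cone_left hg hgC hwC).symm
    · exact ⟨3, Or.inl ⟨hwC, hw⟩⟩
  · rcases hf with ⟨hfC, hf⟩ | ⟨hfC, hf⟩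
    · obtain ⟨h1, h2⟩ := hC.mul_mem_cone_left hf hfC (inv_mem hgC)
      exact ⟨1, Or.inl (by rw [pow_one]; exact (hC.mul_mem_cone_right h1 h2 hgC).symm)⟩
    · exact ⟨3, Or.inr ⟨mul_mem (mul_mem (inv_mem hgC) hfC) (pow_mem hgC 3),
        ho.conj_cube_mem hf hg⟩⟩

theorem le_of_flip_eq {D : Subgroup G} (hC : o.IsConvex C) (hD : o.IsConvex D)
    (h : hC.flip = hD.flip) : C ≤ D := by
  have key : ∀ x ∈ C, x ∈ o.cone → x ∈ D := by
    intro x hx hpos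
    by_contra hxD
    have h1 : x ∈ hD.flip.cone := hD.mem_cone_flip.2 (Or.inl ⟨hxD, hpos⟩)
    rw [← h, mem_cone_flip] at h1
    rcases h1 with ⟨h1, -⟩ | ⟨-, h1⟩
    · exact h1 hx
    · exact hxD (by rw [o.eq_one_of_mem_cone hpos h1]; exact one_mem D)
  intro x hx
  rcases o.mem_cone_or x with hpos | hpos
  · exact key x hx hpos
  · exact inv_mem_iff.1 (key _ (inv_mem hx) hpos)

end IsConvex

/-- A Conradian order with finitely many companions has finitely many convex subgroups. -/
theorem finite_isConvex [Finite (COrder G)] {o : LeftOrder G} (ho : o.IsConradian) :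
    Finite {C : Subgroup G // o.IsConvex C} := by
  refine Finite.of_injective (β := COrder G)
    (fun C : {C : Subgroup G // o.IsConvex C} =>
      (⟨C.2.flip, C.2.isConradian_flip ho⟩ : COrder G)) fun C D h => ?_
  have h' : C.2.flip = D.2.flip := congrArg Subtype.val h
  exact Subtype.ext (_root_.le_antisymm (C.2.le_of_flip_eq D.2 h') (D.2.le_of_flip_eq C.2 h'.symm))

/-! ### Lexicographic orders on extensions -/

section Extension

variable {N Q : Type*} [Group N] [Group Q] {i : N →* G} {p : G →* Q}

/-- The lexicographic order on an extension of `Q` by `N`. -/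
def lex (oN : LeftOrder N) (oQ : LeftOrder Q) (hi : Function.Injective i)
    (hk : i.range = p.ker) : LeftOrder G :=
  ofCone {g | (p g ≠ 1 ∧ p g ∈ oQ.cone) ∨ ∃ n ∈ oN.cone, i n = g}
    (Or.inr ⟨1, oN.one_mem_cone, map_one i⟩)
    (by
      have hpi : ∀ n, p (i n) = 1 := fun n => by
        rw [← MonoidHom.mem_ker, ← hk]; exact ⟨n, rfl⟩
      rintro a (⟨ha1, ha⟩ | ⟨n, hn, rfl⟩) b (⟨hb1, hb⟩ | ⟨m, hm, rfl⟩)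
      · refine Or.inl ⟨fun h => ha1 (oQ.eq_one_of_mul_eq_one ha hb (by rwa [← map_mul])), ?_⟩
        rw [map_mul]; exact oQ.mul_mem_cone ha hb
      · exact Or.inl ⟨by rwa [map_mul, hpi, mul_one], by rwa [map_mul, hpi, mul_one]⟩
      · exact Or.inl ⟨by rwa [map_mul, hpi, one_mul], by rwa [map_mul, hpi, one_mul]⟩
      · exact Or.inr ⟨n * m, oN.mul_mem_cone hn hm, map_mul i n m⟩)
    (by
      have hpi : ∀ n, p (i n) = 1 := fun n => by
        rw [← MonoidHom.mem_ker, ← hk]; exact ⟨n, rfl⟩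
      rintro a (⟨ha1, ha⟩ | ⟨n, hn, rfl⟩) (⟨hb1, hb⟩ | ⟨m, hm, h⟩)
      · exact absurd (oQ.eq_one_of_mem_cone ha (by simpa using hb)) ha1
      · exact absurd (by rw [← inv_inv a, ← h, map_inv, hpi, inv_one]) ha1
      · exact absurd (by rw [map_inv, hpi, inv_one]) hb1
      · rw [← map_inv] at h
        rw [hi h] at hm
        rw [oN.eq_one_of_mem_cone hn hm, map_one])
    (by
      intro a
      by_cases ha : p a = 1
      · rw [← MonoidHom.mem_ker, ← hk] at ha
        obtain ⟨n, rfl⟩ := ha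
        rcases oN.mem_cone_or n with h | h
        · exact Or.inl (Or.inr ⟨n, h, rfl⟩)
        · exact Or.inr (Or.inr ⟨_, h, map_inv i n⟩)
      · rcases oQ.mem_cone_or (p a) with h | h
        · exact Or.inl (Or.inl ⟨ha, h⟩)
        · exact Or.inr (Or.inl ⟨by simpa using ha, by simpa using h⟩))

theorem mem_cone_lex {oN : LeftOrder N} {oQ : LeftOrder Q} {hi : Function.Injective i}
    {hk : i.range = p.ker} {g : G} : g ∈ (lex oN oQ hi hk).cone ↔
      (p g ≠ 1 ∧ p g ∈ oQ.cone) ∨ ∃ n ∈ oN.cone, i n = g := by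
  rw [lex, cone_ofCone]; rfl

/-- For `g` outside the kernel, exponent 2 gives a nonnegative image in the quotient, and a third
`g` makes it nontrivial. For `g` in the kernel, the quotient decides if `f` is outside; otherwise
the claim is that of `N`. -/
theorem isConradian_lex {oN : LeftOrder N} {oQ : LeftOrder Q} (hN : oN.IsConradian)
    (hQ : oQ.IsConradian) (hi : Function.Injective i) (hk : i.range = p.ker) :
    (lex oN oQ hi hk).IsConradian := by
  have hpi : ∀ n, p (i n) = 1 := fun n => by
    rw [← MonoidHom.mem_ker, ← hk]; exact ⟨n, rfl⟩
  refine isConradian_of_cone _ fun f hf g hg _ _ => ?_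
  simp only [mem_cone_lex] at hf hg ⊢
  rcases hg with ⟨hg1, hg⟩ | ⟨m, hm, rfl⟩
  · have hf' : p f ∈ oQ.cone := by
      rcases hf with ⟨-, hf⟩ | ⟨n, hn, rfl⟩
      · exact hf
      · rw [hpi]; exact oQ.one_mem_cone
    have hw := hQ.conj_sq_mem hf' hg
    have h3 : p (g⁻¹ * f * g ^ 3) = (p g)⁻¹ * p f * p g ^ 2 * p g := by
      rw [map_mul, map_mul, map_inv, map_pow]; group
    refine ⟨3, Or.inl ⟨fun h => hg1 ?_, by rw [h3]; exact oQ.mul_mem_cone hw hg⟩⟩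
    rw [h3] at h
    have := oQ.eq_one_of_mul_eq_one hw hg h
    rwa [this, one_mul] at h
  · rcases hf with ⟨hf1, hf⟩ | ⟨n, hn, rfl⟩
    · exact ⟨0, Or.inl ⟨by simpa [hpi] using hf1, by simpa [hpi] using hf⟩⟩
    · exact ⟨2, Or.inr ⟨_, hN.conj_sq_mem hn hm, by simp⟩⟩

theorem isConvex_ker_lex (oN : LeftOrder N) (oQ : LeftOrder Q) (hi : Function.Injective i)
    (hk : i.range = p.ker) : (lex oN oQ hi hk).IsConvex p.ker := by
  intro x y hx hxy hy
  rw [MonoidHom.mem_ker] at *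
  rw [le_iff_mem_cone, mem_cone_lex, map_mul, hy, mul_one, map_inv] at hxy
  change x ∈ (lex oN oQ hi hk).cone at hx
  by_contra hx1
  rw [mem_cone_lex] at hx
  rcases hx with ⟨-, hx⟩ | ⟨n, -, rfl⟩
  · rcases hxy with ⟨-, h⟩ | ⟨n, -, h⟩
    · exact hx1 (oQ.eq_one_of_mem_cone hx h)
    · have h2 : x⁻¹ * y ∈ p.ker := by rw [← hk]; exact ⟨n, h⟩
      rw [MonoidHom.mem_ker, map_mul, hy, mul_one, map_inv, inv_eq_one] at h2
      exact hx1 h2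
  · exact hx1 (by rw [← MonoidHom.mem_ker, ← hk]; exact ⟨n, rfl⟩)

theorem lex_injective (hi : Function.Injective i) (hp : Function.Surjective p)
    (hk : i.range = p.ker) {oN oN' : LeftOrder N} {oQ oQ' : LeftOrder Q}
    (h : lex oN oQ hi hk = lex oN' oQ' hi hk) : oN = oN' ∧ oQ = oQ' := by
  have hpi : ∀ n, p (i n) = 1 := fun n => by
    rw [← MonoidHom.mem_ker, ← hk]; exact ⟨n, rfl⟩
  constructor
  · refine eq_of_cone_subset fun n hn => ?_
    have h1 : i n ∈ (lex oN oQ hi hk).cone := mem_cone_lex.2 (Or.inr ⟨n, hn, rfl⟩)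
    rw [h, mem_cone_lex] at h1
    rcases h1 with ⟨h1, -⟩ | ⟨m, hm, h1⟩
    · exact absurd (hpi n) h1
    · rwa [← hi h1]
  · refine eq_of_cone_subset fun a ha => ?_
    by_cases ha1 : a = 1
    · rw [ha1]; exact oQ'.one_mem_cone
    obtain ⟨g, rfl⟩ := hp a
    have h1 : g ∈ (lex oN oQ hi hk).cone := mem_cone_lex.2 (Or.inl ⟨ha1, ha⟩)
    rw [h, mem_cone_lex] at h1
    rcases h1 with ⟨-, h1⟩ | ⟨m, hm, rfl⟩
    · exact h1
    · exact absurd (hpi m) ha1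

/-- Multiplying by an element of a convex kernel does not change the sign of an element outside it,
so the order is recovered from kernel and quotient. -/
theorem lex_comap_map {o : LeftOrder G} (hi : Function.Injective i)
    (hp : Function.Surjective p) (hk : i.range = p.ker) (hc : o.IsConvex p.ker) :
    lex (o.comap i hi) (o.map p hp hc) hi hk = o := by
  refine eq_of_cone_subset fun g hg => ?_
  rw [mem_cone_lex] at hg
  rcases hg with ⟨hg1, hg⟩ | ⟨n, hn, rfl⟩
  · rw [cone_map] at hg
    obtain ⟨x, hx, hxg⟩ := hg
    have hxk : x ∉ p.ker := by rwa [MonoidHom.mem_ker, hxg]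
    have := (hc.mul_mem_cone_right (c := x⁻¹ * g) hx hxk
      (by rw [MonoidHom.mem_ker, map_mul, map_inv, hxg, inv_mul_cancel])).1
    simpa using this
  · exact mem_cone_comap.1 hn

end Extension

end LeftOrder

namespace COrder

variable {G N Q : Type*} [Group G] [Group N] [Group Q] {i : N →* G} {p : G →* Q}

/-- The lexicographic `C`-order on an extension. -/
def lex (hi : Function.Injective i) (hk : i.range = p.ker) (o : COrder N × COrder Q) :
    COrder G :=
  ⟨LeftOrder.lex o.1.1 o.2.1 hi hk, LeftOrder.isConradian_lex o.1.2 o.2.2 hi hk⟩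

theorem lex_injective (hi : Function.Injective i) (hp : Function.Surjective p)
    (hk : i.range = p.ker) : Function.Injective (lex hi hk) := by
  rintro ⟨a, b⟩ ⟨c, d⟩ h
  obtain ⟨h1, h2⟩ := LeftOrder.lex_injective hi hp hk (congrArg Subtype.val h)
  exact Prod.ext (Subtype.ext h1) (Subtype.ext h2)

theorem lex_surjective (hi : Function.Injective i) (hp : Function.Surjective p)
    (hk : i.range = p.ker) (hQ : ∀ a b : Q, a * b = b * a)
    (hc : ∀ o : LeftOrder G, o.IsConradian → o.IsConvex p.ker) :
    Function.Surjective (lex hi hk) := fun o =>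
  ⟨(⟨o.1.comap i hi, o.2.comap i hi⟩, ⟨o.1.map p hp (hc _ o.2),
    LeftOrder.isConradian_of_comm _ hQ⟩),
    Subtype.ext (LeftOrder.lex_comap_map hi hp hk (hc _ o.2))⟩

end COrder

/-! ### Torsion-free abelian groups -/

/-- An elementwise description of torsion-free abelian groups of rank one. -/
structure IsRankOneGroup (Q : Type*) [Group Q] : Prop where
  mul_comm : ∀ a b : Q, a * b = b * a
  eq_one_of_pow : ∀ (a : Q) (n : ℕ), n ≠ 0 → a ^ n = 1 → a = 1
  exists_ne_one : ∃ a : Q, a ≠ 1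
  exists_zpow_eq : ∀ a b : Q, a ≠ 1 → b ≠ 1 → ∃ m n : ℤ, m ≠ 0 ∧ n ≠ 0 ∧ a ^ m = b ^ n

theorem isMulTorsionFree_of_eq_one {A : Type*} [CommGroup A]
    (h : ∀ (a : A) (n : ℕ), n ≠ 0 → a ^ n = 1 → a = 1) : IsMulTorsionFree A :=
  ⟨fun n hn a b hab => by
    have hab' : a ^ n = b ^ n := hab
    exact div_eq_one.1 (h (a / b) n hn (by rw [div_pow, hab', div_self']))⟩

theorem isTorsionFreeRankOne_iff {A : Type*} [CommGroup A] :
    IsTorsionFreeRankOne A ↔ IsRankOneGroup A := by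
  constructor
  · rintro ⟨h1, h2⟩
    have hne : ∃ a : A, a ≠ 1 := by
      have h3 : 0 < Module.rank ℤ (Additive A) := by rw [h2]; exact one_pos
      obtain ⟨x, hx⟩ := rank_pos_iff_exists_ne_zero.1 h3
      exact ⟨x.toMul, fun h => hx (Additive.toMul.injective h)⟩
    refine ⟨mul_comm, fun a n hn h => (pow_eq_one_iff_left hn).1 h, hne, fun a b ha hb => ?_⟩
    have hnot : ¬ LinearIndependent ℤ ![Additive.ofMul a, Additive.ofMul b] := by
      intro hli
      have := hli.cardinal_lift_le_rank
      rw [h2] at this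
      norm_num at this
    rw [LinearIndependent.pair_iff] at hnot
    push Not at hnot
    obtain ⟨s, t, hst, hne⟩ := hnot
    have hst' : a ^ s * b ^ t = 1 := hst
    have ht : t ≠ 0 := by
      rintro rfl
      rw [zpow_zero, mul_one] at hst'
      by_cases hs : s = 0
      · exact hne hs rfl
      · exact ha ((IsMulTorsionFree.zpow_eq_one_iff_left hs).1 hst')
    have hs : s ≠ 0 := by
      rintro rfl
      rw [zpow_zero, one_mul] at hst'
      exact hb ((IsMulTorsionFree.zpow_eq_one_iff_left ht).1 hst')
    refine ⟨s, -t, hs, neg_ne_zero.2 ht, ?_⟩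
    rw [zpow_neg]
    exact eq_inv_of_mul_eq_one_left hst'
  · intro h
    have htf := isMulTorsionFree_of_eq_one h.eq_one_of_pow
    refine ⟨htf, le_antisymm ?_ ?_⟩
    · have := rank_le (R := ℤ) (M := Additive A) (n := 1) ?_
      · exact_mod_cast this
      intro s hs
      by_contra! hcard
      obtain ⟨x, hx, y, hy, hxy⟩ := Finset.one_lt_card.1 hcard
      have hli : LinearIndependent ℤ ![x, y] := by
        have hinj : Function.Injective (![⟨x, hx⟩, ⟨y, hy⟩] : Fin 2 → s) := by
          intro i j hij
          fin_cases i <;> fin_cases j <;> simp_all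
        have h1 := hs.comp _ hinj
        convert! h1 using 1
        ext i
        fin_cases i <;> rfl
      have hx0 := hli.ne_zero 0
      have hy0 := hli.ne_zero 1
      obtain ⟨m, n, hm, hn, hmn⟩ := h.exists_zpow_eq x.toMul y.toMul hx0 hy0
      have hmn' : m • x + (-n) • y = 0 := by
        have : m • x = n • y := hmn
        rw [this, neg_smul, add_neg_cancel]
      exact hm (LinearIndependent.pair_iff.1 hli _ _ hmn').1
    · obtain ⟨a, ha⟩ := h.exists_ne_one
      rw [Cardinal.one_le_iff_pos, rank_pos_iff_exists_ne_zero]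
      exact ⟨Additive.ofMul a, fun h => ha (Additive.ofMul.injective h)⟩

theorem isTorsionFreeRankOneAbelian_iff {Q : Type*} [inst : Group Q] :
    IsTorsionFreeRankOneAbelian Q ↔ IsRankOneGroup Q := by
  constructor
  · rintro ⟨hcomm, h⟩
    exact (@isTorsionFreeRankOne_iff Q { inst with mul_comm := hcomm }).1 h
  · intro h
    exact ⟨h.mul_comm, (@isTorsionFreeRankOne_iff Q { inst with mul_comm := h.mul_comm }).2 h⟩

/-- Torsion-free abelian groups are orderable. -/
theorem exists_leftOrder_of_torsionFree {A : Type*} [CommGroup A] [IsMulTorsionFree A] :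
    Nonempty (LeftOrder A) := by
  classical
  -- Embed `A` in the rational vector space given by its divisible hull and compare coordinates
  -- lexicographically.
  let B := Module.Basis.ofVectorSpace ℚ (DivisibleHull (Additive A))
  let _ : LinearOrder (Module.Basis.ofVectorSpaceIndex ℚ (DivisibleHull (Additive A))) := linearOrderOfSTO WellOrderingRel
  let f : A → Lex (Module.Basis.ofVectorSpaceIndex ℚ (DivisibleHull (Additive A)) →₀ ℚ) :=
    fun a => toLex (B.repr ((Additive.ofMul a : Additive A) : DivisibleHull (Additive A)))
  have hf : Function.Injective f := fun a b hab =>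
    Additive.ofMul.injective (DivisibleHull.coe_injective (B.repr.injective (toLex.injective hab)))
  have hmul : ∀ a b, f (a * b) = f a + f b := fun a b => by
    simp only [f, ofMul_mul, DivisibleHull.coe_add, map_add, toLex_add]
  exact ⟨{
    le := fun a b => f a ≤ f b
    le_refl := fun a => le_rfl
    le_trans := fun a b c => le_trans
    le_antisymm := fun a b h h' => hf (le_antisymm h h')
    le_total := fun a b => le_total _ _
    mul_le_mul_left := fun a b c h => by
      rw [hmul, hmul]; exact add_le_add_right h _ }⟩

theorem cOrderable_of_torsionFree {A : Type*} [inst : Group A] (hcomm : ∀ a b : A, a * b = b * a)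
    (htf : ∀ (a : A) (n : ℕ), n ≠ 0 → a ^ n = 1 → a = 1) : COrderable A := by
  let _ : CommGroup A := { inst with mul_comm := hcomm }
  have := isMulTorsionFree_of_eq_one htf
  obtain ⟨o⟩ := exists_leftOrder_of_torsionFree (A := A)
  exact ⟨⟨o, o.isConradian_of_comm hcomm⟩⟩

namespace LeftOrder

theorem IsConvex.le_total {G : Type*} [Group G] {o : LeftOrder G} {C D : Subgroup G}
    (hC : o.IsConvex C) (hD : o.IsConvex D) : C ≤ D ∨ D ≤ C :=
  let _ := o.linearOrder
  have := o.mulLeftMono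
  IsConvexSubgroup.le_total (C := C) hC hD

theorem isConvex_bot {G : Type*} [Group G] (o : LeftOrder G) : o.IsConvex ⊥ := by
  intro x y hx hxy hy
  rw [Subgroup.mem_bot] at *
  subst hy
  exact (o.le_antisymm _ _ hx hxy).symm

theorem isConvex_top {G : Type*} [Group G] (o : LeftOrder G) : o.IsConvex ⊤ :=
  fun _ _ _ _ _ => trivial

end LeftOrder

/-- A nontrivial torsion-free abelian group with finitely many orders has rank one. -/
theorem isRankOneGroup_of_finite {A : Type*} [inst : Group A]
    (hcomm : ∀ a b : A, a * b = b * a)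
    (htf : ∀ (a : A) (n : ℕ), n ≠ 0 → a ^ n = 1 → a = 1) (hne : ∃ a : A, a ≠ 1)
    [Finite (COrder A)] : IsRankOneGroup A := by
  refine ⟨hcomm, htf, hne, fun a b ha hb => ?_⟩
  let _ : CommGroup A := { inst with mul_comm := hcomm }
  have := isMulTorsionFree_of_eq_one htf
  -- The isolator of the cyclic subgroup generated by `a * b ^ n`. Both it and its quotient are
  -- torsion-free, so a lexicographic order makes it convex.
  let I : ℕ → Subgroup A := fun n =>
    { carrier := {x | ∃ k l : ℤ, k ≠ 0 ∧ x ^ k = (a * b ^ n) ^ l}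
      one_mem' := ⟨1, 0, one_ne_zero, by simp⟩
      mul_mem' := by
        rintro x y ⟨k, l, hk, h⟩ ⟨k', l', hk', h'⟩
        refine ⟨k * k', l * k' + l' * k, mul_ne_zero hk hk', ?_⟩
        rw [mul_zpow, zpow_mul, h, mul_comm k k', zpow_mul y, h', zpow_add, zpow_mul, zpow_mul]
      inv_mem' := by
        rintro x ⟨k, l, hk, h⟩
        exact ⟨k, -l, hk, by rw [inv_zpow, h, zpow_neg]⟩ }
  have hI : ∀ n, a * b ^ n ∈ I n := fun n => ⟨1, 1, one_ne_zero, rfl⟩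
  have hord : ∀ n, ∃ o : COrder A, o.1.IsConvex (I n) := by
    intro n
    obtain ⟨oN⟩ := cOrderable_of_torsionFree (A := I n) (fun x y => mul_comm x y)
      (fun x k hk h => Subtype.ext (htf x k hk (congrArg Subtype.val h)))
    obtain ⟨oQ⟩ := cOrderable_of_torsionFree (A := A ⧸ I n) (fun x y => mul_comm x y) (by
      intro x k hk h
      induction x using QuotientGroup.induction_on with
      | H x =>
        rw [← QuotientGroup.mk_pow, QuotientGroup.eq_one_iff] at h
        rw [QuotientGroup.eq_one_iff]
        obtain ⟨k', l, hk', h⟩ := h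
        exact ⟨k * k', l, mul_ne_zero (by exact_mod_cast hk) hk', by
          rw [zpow_mul, zpow_natCast, h]⟩)
    have hk : (I n).subtype.range = (QuotientGroup.mk' (I n)).ker := by
      rw [QuotientGroup.ker_mk', Subgroup.range_subtype]
    refine ⟨COrder.lex (Subgroup.subtype_injective _) hk (oN, oQ), ?_⟩
    have := LeftOrder.isConvex_ker_lex oN.1 oQ.1 (Subgroup.subtype_injective _) hk
    rwa [QuotientGroup.ker_mk'] at this
  choose o ho using hord
  -- Two of these subgroups are convex for the same order, hence nested, and this relates `a` to
  -- `b`.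
  obtain ⟨m, n, hmn, heq⟩ := Finite.exists_ne_map_eq_of_infinite o
  have key : ∀ m n : ℕ, m ≠ n → I m ≤ I n → ∃ m n : ℤ, m ≠ 0 ∧ n ≠ 0 ∧ a ^ m = b ^ n := by
    intro m n hmn hle
    obtain ⟨k, l, hk, h⟩ := hle (hI m)
    rw [mul_zpow, mul_zpow, ← zpow_natCast, ← zpow_natCast, ← zpow_mul, ← zpow_mul] at h
    have h1 : a ^ (k - l) = b ^ (n * l - m * k) := by
      rw [zpow_sub, zpow_sub, ← div_eq_mul_inv, ← div_eq_mul_inv, div_eq_div_iff_mul_eq_mul, h,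
        mul_comm]
    by_cases hkl : k - l = 0
    · have hkl' : l = k := by omega
      subst hkl'
      rw [hkl, zpow_zero, ← sub_mul] at h1
      have h2 : ((n : ℤ) - m) * l ≠ 0 := mul_ne_zero (by omega) hk
      exact absurd ((IsMulTorsionFree.zpow_eq_one_iff_left h2).1 h1.symm) hb
    · refine ⟨_, _, hkl, fun h2 => ?_, h1⟩
      rw [h2, zpow_zero] at h1
      exact ha ((IsMulTorsionFree.zpow_eq_one_iff_left hkl).1 h1)
  have hn : (o m).1.IsConvex (I n) := by rw [heq]; exact ho n
  rcases (ho m).le_total hn with h | h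
  · exact key m n hmn h
  · exact key n m hmn.symm h

/-- A torsion-free abelian group of rank one has exactly two orders. -/
theorem IsRankOneGroup.card_cOrder {A : Type*} [Group A] (h : IsRankOneGroup A) :
    Nat.card (COrder A) = 2 := by
  classical
  obtain ⟨a, ha⟩ := h.exists_ne_one
  obtain ⟨o⟩ := cOrderable_of_torsionFree h.mul_comm h.eq_one_of_pow
  -- The sign of `a` determines the order, since every nontrivial element shares a nontrivial power
  -- with `a`; `Prop` serves as the two-element set of signs.
  let F : COrder A → Prop := fun o => a ∈ o.1.cone
  have hinv : ∀ o : COrder A, a ∈ o.1.cone → a⁻¹ ∉ o.1.cone := fun o h1 h2 =>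
    ha (o.1.eq_one_of_mem_cone h1 h2)
  have zpow_mem : ∀ (o : COrder A) (x : A) (k : ℤ), 0 ≤ k → x ∈ o.1.cone → x ^ k ∈ o.1.cone := by
    intro o x k hk hx
    lift k to ℕ using hk
    rw [zpow_natCast]
    exact o.1.pow_mem_cone hx k
  have key : ∀ (o o' : COrder A) (a x : A) (m n : ℤ), a ∈ o.1.cone → a ∈ o'.1.cone →
      a ≠ 1 → x ≠ 1 → m ≠ 0 → 0 < n → a ^ m = x ^ n → x ∈ o.1.cone → x ∈ o'.1.cone := by
    intro o o' a x m n hao hao' ha1 hx1 hm hn hax hx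
    refine (o'.1.mem_cone_or x).resolve_right fun hx' => hx1 ?_
    have h1 : x ^ n ∈ o.1.cone := zpow_mem o x n hn.le hx
    have h2 : (x ^ n)⁻¹ ∈ o'.1.cone := by
      rw [← inv_zpow]; exact zpow_mem o' x⁻¹ n hn.le hx'
    have h3 : x ^ n = 1 := by
      rw [← hax] at h1 h2 ⊢
      rcases le_total 0 m with hm0 | hm0
      · exact o'.1.eq_one_of_mem_cone (zpow_mem o' a m hm0 hao') h2
      · refine o.1.eq_one_of_mem_cone h1 ?_
        rw [← zpow_neg]
        exact zpow_mem o a _ (by omega) hao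
    lift n to ℕ using hn.le
    rw [zpow_natCast] at h3
    exact h.eq_one_of_pow x n (by omega) h3
  have key' : ∀ (o o' : COrder A) (a : A), a ∈ o.1.cone → a ∈ o'.1.cone → a ≠ 1 → o = o' := by
    intro o o' a hao hao' ha1
    refine Subtype.ext (LeftOrder.eq_of_cone_subset fun x hx => ?_)
    by_cases hx1 : x = 1
    · rw [hx1]; exact o'.1.one_mem_cone
    obtain ⟨m, n, hm, hn, hmn⟩ := h.exists_zpow_eq a x ha1 hx1
    rcases lt_or_gt_of_ne hn with hn' | hn'
    · exact key o o' a x (-m) (-n) hao hao' ha1 hx1 (neg_ne_zero.2 hm) (by omega)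
        (by rw [zpow_neg, zpow_neg, hmn]) hx
    · exact key o o' a x m n hao hao' ha1 hx1 hm hn' hmn hx
  have hFinj : Function.Injective F := by
    intro o o' hoo
    by_cases hao : a ∈ o.1.cone
    · exact key' o o' a hao (hoo ▸ hao : F o') ha
    · have hao' : a ∉ o'.1.cone := fun hh => hao (hoo.symm ▸ hh : F o)
      exact key' o o' a⁻¹ ((o.1.mem_cone_or a).resolve_left hao)
        ((o'.1.mem_cone_or a).resolve_left hao') (inv_ne_one.2 ha)
  let o' : COrder A := ⟨o.1.isConvex_top.flip, o.1.isConvex_top.isConradian_flip o.2⟩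
  have ho' : ∀ x, x ∈ o'.1.cone ↔ x⁻¹ ∈ o.1.cone := fun x => by
    simp [o', LeftOrder.IsConvex.mem_cone_flip]
  have hFsurj : Function.Surjective F := by
    intro P
    by_cases hao : a ∈ o.1.cone
    · by_cases hP : P
      · exact ⟨o, by simp [F, hao, hP]⟩
      · exact ⟨o', by simp [F, ho', hinv o hao, hP]⟩
    · have hao' := (o.1.mem_cone_or a).resolve_left hao
      by_cases hP : P
      · exact ⟨o', by simp [F, ho', hao', hP]⟩
      · exact ⟨o, by simp [F, hao, hP]⟩
  rw [Nat.card_eq_of_bijective F ⟨hFinj, hFsurj⟩]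
  simp

/-! ### Conradian orders and maximal convex subgroups -/

namespace LeftOrder

variable {G : Type*} [Group G] {o : LeftOrder G}

theorem exists_isConvex_of_mem_cone (ho : o.IsConradian) {g : G} (hg : g ∈ o.cone) (hg1 : g ≠ 1) :
    ∃ D : Subgroup G, o.IsConvex D ∧
      ∀ x, x ∈ D ↔ ∃ n : ℕ, o.le x (g ^ n) ∧ o.le x⁻¹ (g ^ n) :=
  let _ := o.linearOrder
  have := o.mulLeftMono
  have hC := o.isConradian_iff_conradProperty.1 ho
  have hg' : 1 < g := lt_of_le_of_ne' (show 1 ≤ g from hg) hg1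
  ⟨hC.powHull hg', hC.isConvexSubgroup_powHull hg', fun _ => Iff.rfl⟩

namespace IsConvex

variable {C : Subgroup G}

theorem mem_of_pow_mem (hC : o.IsConvex C) {g : G} {n : ℕ} (hn : n ≠ 0) (h : g ^ n ∈ C) :
    g ∈ C := by
  obtain ⟨m, rfl⟩ := Nat.exists_eq_succ_of_ne_zero hn
  have pos : ∀ x ∈ o.cone, x ^ m.succ ∈ C → x ∈ C := by
    intro x hx hxn
    refine hC x _ hx ?_ hxn
    rw [le_iff_mem_cone, pow_succ', inv_mul_cancel_left]
    exact o.pow_mem_cone hx m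
  rcases o.mem_cone_or g with h1 | h1
  · exact pos g h1 h
  · exact inv_mem_iff.1 (pos _ h1 (by rw [inv_pow]; exact inv_mem h))

/-- Conrad: the quotient by a maximal proper convex subgroup of a Conradian order is
commutative. -/
theorem commutator_mem (hC : o.IsConvex C) (ho : o.IsConradian)
    (hmax : ∀ D : Subgroup G, o.IsConvex D → D ≤ C ∨ D = ⊤) (a b : G) :
    a * b * a⁻¹ * b⁻¹ ∈ C := by
  -- The convex subgroup generated by `g` is not inside `C`, so maximality makes it the whole group.
  -- This cofinality yields both normality and the Archimedean quotient.
  have hcof : ∀ g : G, g ∉ C → g ∈ o.cone → ∀ x : G, ∃ n : ℕ, o.le x (g ^ n) := by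
    intro g hgC hg x
    obtain ⟨D, hD, hmem⟩ := exists_isConvex_of_mem_cone ho hg (fun h => hgC (h ▸ one_mem C))
    have hgD : g ∈ D := (hmem g).2 ⟨1, by rw [pow_one]; exact o.le_refl g, by
      rw [le_iff_mem_cone]; simpa using o.mul_mem_cone hg hg⟩
    rcases hmax D hD with h | h
    · exact absurd (h hgD) hgC
    · obtain ⟨n, hn, -⟩ := (hmem x).1 (h ▸ Subgroup.mem_top x)
      exact ⟨n, hn⟩
  have hnormal : C.Normal := by
    let _ := o.linearOrder
    have := o.mulLeftMono
    exact IsConvexSubgroup.normal_of_cofinal (o.isConradian_iff_conradProperty.1 ho) hC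
      fun g hg h1 x => hcof g hg h1.le x
  have hker : o.IsConvex (QuotientGroup.mk' C).ker := by rwa [QuotientGroup.ker_mk']
  let oQ := o.map (QuotientGroup.mk' C) (QuotientGroup.mk'_surjective C) hker
  have hcomm : ∀ x y : G ⧸ C, x * y = y * x := by
    let _ := oQ.linearOrder
    have := oQ.mulLeftMono
    refine mul_comm_of_archimedean fun g hg x => ?_
    have hg' : g ∈ oQ.cone := hg.le
    rw [cone_map] at hg'
    obtain ⟨y, hy, rfl⟩ := hg'
    obtain ⟨x, rfl⟩ := QuotientGroup.mk'_surjective C x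
    have hyC : y ∉ C := fun h => hg.ne' ((QuotientGroup.eq_one_iff y).2 h)
    obtain ⟨n, hn⟩ := hcof y hyC hy x
    refine ⟨n, (oQ.le_iff_mem_cone _ _).2 ?_⟩
    rw [cone_map]
    exact ⟨x⁻¹ * y ^ n, (o.le_iff_mem_cone _ _).1 hn, by simp⟩
  rw [← QuotientGroup.eq_one_iff]
  have := hcomm a b
  simp only [QuotientGroup.mk_mul, QuotientGroup.mk_inv]
  rw [this, mul_inv_cancel_right, mul_inv_cancel]

end IsConvex

end LeftOrder

/-- If a nontrivial group has finitely many `C`-orders, then some proper subgroup contains all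
commutators and is closed under roots. -/
theorem exists_ne_top_commutator_mem {G : Type*} [Group G] [Nontrivial G] [Finite (COrder G)]
    (h : COrderable G) : ∃ C : Subgroup G, C ≠ ⊤ ∧ (∀ a b : G, a * b * a⁻¹ * b⁻¹ ∈ C) ∧
      ∀ (g : G) (n : ℕ), n ≠ 0 → g ^ n ∈ C → g ∈ C := by
  obtain ⟨o, ho⟩ := h
  have hfin := LeftOrder.finite_isConvex ho
  have hfin' : {C : Subgroup G | o.IsConvex C ∧ C ≠ ⊤}.Finite :=
    Set.Finite.subset (s := {C : Subgroup G | o.IsConvex C}) hfin fun C hC => hC.1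
  obtain ⟨C, ⟨hC, hCtop⟩, hmax⟩ := hfin'.exists_maximal ⟨⊥, o.isConvex_bot, bot_ne_top⟩
  refine ⟨C, hCtop, hC.commutator_mem ho fun D hD => ?_, fun g n hn hg => hC.mem_of_pow_mem hn hg⟩
  by_cases hDtop : D = ⊤
  · exact Or.inr hDtop
  · rcases hC.le_total hD with h | h
    · exact Or.inl (hmax ⟨hD, hDtop⟩ h)
    · exact Or.inl h

/-! ### Rank-one sections -/

theorem Subgroup.quotient_mul_comm {G : Type*} [Group G] {H N : Subgroup G} [(N.subgroupOf H).Normal]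
    (h : ∀ a ∈ H, ∀ b ∈ H, a * b * a⁻¹ * b⁻¹ ∈ N) (a b : H ⧸ N.subgroupOf H) :
    a * b = b * a := by
  induction a using QuotientGroup.induction_on with
  | H a =>
    induction b using QuotientGroup.induction_on with
    | H b =>
      have : ((a * b * a⁻¹ * b⁻¹ : H) : H ⧸ N.subgroupOf H) = 1 := by
        rw [QuotientGroup.eq_one_iff, Subgroup.mem_subgroupOf]
        exact h a a.2 b b.2
      simp only [QuotientGroup.mk_mul, QuotientGroup.mk_inv] at this
      rwa [mul_inv_eq_one, mul_inv_eq_iff_eq_mul] at this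

/-- Elementwise description of a normal inclusion `N ≤ H` with torsion-free abelian quotient of
rank one. -/
structure IsRankOneSection {G : Type*} [Group G] (H N : Subgroup G) : Prop where
  commutator_mem : ∀ a ∈ H, ∀ b ∈ H, a * b * a⁻¹ * b⁻¹ ∈ N
  mem_of_pow : ∀ a ∈ H, ∀ n : ℕ, n ≠ 0 → a ^ n ∈ N → a ∈ N
  exists_notMem : ∃ a ∈ H, a ∉ N
  exists_zpow : ∀ a ∈ H, ∀ b ∈ H, a ∉ N → b ∉ N →
    ∃ m n : ℤ, m ≠ 0 ∧ n ≠ 0 ∧ a ^ m * b ^ n ∈ N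

theorem isRankOneGroup_quotient_iff {G : Type*} [Group G] (H N : Subgroup G)
    [(N.subgroupOf H).Normal] :
    IsRankOneGroup (H ⧸ N.subgroupOf H) ↔ IsRankOneSection H N := by
  have hmk : ∀ x : H, (x : H ⧸ N.subgroupOf H) = 1 ↔ (x : G) ∈ N := fun x => by
    rw [QuotientGroup.eq_one_iff, Subgroup.mem_subgroupOf]
  constructor
  · intro h
    refine ⟨fun a ha b hb => ?_, fun a ha n hn hmem => ?_, ?_, fun a ha b hb haN hbN => ?_⟩
    · refine (hmk (⟨a, ha⟩ * ⟨b, hb⟩ * ⟨a, ha⟩⁻¹ * ⟨b, hb⟩⁻¹)).1 ?_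
      simp only [QuotientGroup.mk_mul, QuotientGroup.mk_inv]
      rw [h.mul_comm (⟨a, ha⟩ : H), mul_inv_cancel_right, mul_inv_cancel]
    · refine (hmk ⟨a, ha⟩).1 (h.eq_one_of_pow _ n hn ?_)
      rw [← QuotientGroup.mk_pow]
      exact (hmk _).2 hmem
    · obtain ⟨a, ha⟩ := h.exists_ne_one
      induction a using QuotientGroup.induction_on with
      | H a => exact ⟨a, a.2, fun haN => ha ((hmk a).2 haN)⟩
    · obtain ⟨m, n, hm, hn, hmn⟩ := h.exists_zpow_eq (⟨a, ha⟩ : H) (⟨b, hb⟩ : H)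
        (fun h1 => haN ((hmk _).1 h1)) (fun h1 => hbN ((hmk _).1 h1))
      refine ⟨m, -n, hm, neg_ne_zero.2 hn, (hmk (⟨a, ha⟩ ^ m * ⟨b, hb⟩ ^ (-n))).1 ?_⟩
      rw [QuotientGroup.mk_mul, QuotientGroup.mk_zpow, QuotientGroup.mk_zpow, hmn, zpow_neg,
        mul_inv_cancel]
  · intro h
    refine ⟨Subgroup.quotient_mul_comm h.commutator_mem, fun a n hn hmem => ?_, ?_,
      fun a b haN hbN => ?_⟩
    · induction a using QuotientGroup.induction_on with
      | H a =>
        rw [← QuotientGroup.mk_pow, hmk] at hmem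
        exact (hmk a).2 (h.mem_of_pow a a.2 n hn hmem)
    · obtain ⟨a, ha, haN⟩ := h.exists_notMem
      exact ⟨(⟨a, ha⟩ : H), fun h1 => haN ((hmk _).1 h1)⟩
    · induction a using QuotientGroup.induction_on with
      | H a =>
        induction b using QuotientGroup.induction_on with
        | H b =>
          rw [Ne, hmk] at haN hbN
          obtain ⟨m, n, hm, hn, hmn⟩ := h.exists_zpow a a.2 b b.2 haN hbN
          refine ⟨m, -n, hm, neg_ne_zero.2 hn, ?_⟩
          have := (hmk (a ^ m * b ^ n)).2 hmn
          rw [QuotientGroup.mk_mul, QuotientGroup.mk_zpow, QuotientGroup.mk_zpow] at this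
          rw [zpow_neg]
          exact eq_inv_of_mul_eq_one_left this

/-! ### The isolator of the commutator subgroup -/

section Isolator

variable {G : Type*} [Group G]

/-- The elements of `H` having a nontrivial power in the commutator subgroup of `H`. -/
def Subgroup.commutatorIsolator (H : Subgroup G) : Subgroup G :=
  ((CommGroup.torsion (Abelianization H)).comap Abelianization.of).map H.subtype

theorem Subgroup.mem_commutatorIsolator {H : Subgroup G} {x : G} :
    x ∈ H.commutatorIsolator ↔ x ∈ H ∧ ∃ n : ℕ, n ≠ 0 ∧ x ^ n ∈ ⁅H, H⁆ := by
  have key : ∀ y : H, y ∈ (CommGroup.torsion (Abelianization H)).comap Abelianization.of ↔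
      ∃ n : ℕ, n ≠ 0 ∧ (y : G) ^ n ∈ ⁅H, H⁆ := by
    intro y
    rw [Subgroup.mem_comap, CommGroup.mem_torsion, isOfFinOrder_iff_pow_eq_one]
    refine exists_congr fun n => and_congr Nat.pos_iff_ne_zero ?_
    rw [← map_pow, ← MonoidHom.mem_ker, Abelianization.ker_of, ← map_subtype_commutator,
      Subgroup.mem_map]
    constructor
    · intro h; exact ⟨_, h, rfl⟩
    · rintro ⟨z, hz, h⟩
      rwa [← show z = y ^ n from Subtype.ext h]
  rw [commutatorIsolator, Subgroup.mem_map]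
  constructor
  · rintro ⟨y, hy, rfl⟩
    exact ⟨y.2, (key y).1 hy⟩
  · rintro ⟨hx, h⟩
    exact ⟨⟨x, hx⟩, (key ⟨x, hx⟩).2 h, rfl⟩

theorem Subgroup.commutatorIsolator_le (H : Subgroup G) : H.commutatorIsolator ≤ H :=
  fun _ hx => (mem_commutatorIsolator.1 hx).1

theorem Subgroup.commutatorIsolator_normal (H : Subgroup G) [H.Normal] :
    H.commutatorIsolator.Normal := by
  refine ⟨fun x hx g => ?_⟩
  obtain ⟨h1, n, hn, h2⟩ := mem_commutatorIsolator.1 hx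
  refine mem_commutatorIsolator.2 ⟨Normal.conj_mem inferInstance x h1 g, n, hn, ?_⟩
  rw [conj_pow]
  exact Normal.conj_mem inferInstance _ h2 g

theorem Subgroup.subgroupOf_normal_of_commutator_mem {H N : Subgroup G}
    (h : ∀ a ∈ H, ∀ b ∈ H, a * b * a⁻¹ * b⁻¹ ∈ N) : (N.subgroupOf H).Normal := by
  refine ⟨fun x hx g => ?_⟩
  rw [Subgroup.mem_subgroupOf] at *
  have := mul_mem (h g g.2 x x.2) hx
  simpa using this

theorem Subgroup.commutator_mem_commutatorIsolator {H : Subgroup G} {a b : G} (ha : a ∈ H)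
    (hb : b ∈ H) : a * b * a⁻¹ * b⁻¹ ∈ H.commutatorIsolator :=
  mem_commutatorIsolator.2 ⟨mul_mem (mul_mem (mul_mem ha hb) (inv_mem ha)) (inv_mem hb), 1,
    one_ne_zero, by rw [pow_one]; exact commutator_mem_commutator ha hb⟩

theorem Subgroup.mem_commutatorIsolator_of_pow {H : Subgroup G} {a : G} (ha : a ∈ H) {n : ℕ}
    (hn : n ≠ 0) (h : a ^ n ∈ H.commutatorIsolator) : a ∈ H.commutatorIsolator := by
  obtain ⟨-, m, hm, h'⟩ := mem_commutatorIsolator.1 h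
  exact mem_commutatorIsolator.2 ⟨ha, n * m, mul_ne_zero hn hm, by rwa [pow_mul]⟩

/-- A torsion-free abelian quotient kills all commutators, hence also their roots. -/
theorem IsRankOneSection.commutatorIsolator_le {H N : Subgroup G} (h : IsRankOneSection H N) :
    H.commutatorIsolator ≤ N := by
  intro x hx
  obtain ⟨hx, n, hn, hxn⟩ := Subgroup.mem_commutatorIsolator.1 hx
  refine h.mem_of_pow x hx n hn ?_
  exact (Subgroup.commutator_le.2 fun a ha b hb => h.commutator_mem a ha b hb) hxn

/-- The passage to a section: the lexicographic construction for `N ≤ H`. -/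
theorem COrder.exists_lex_injective {H N : Subgroup G} (hle : N ≤ H) [(N.subgroupOf H).Normal] :
    ∃ F : COrder N × COrder (H ⧸ N.subgroupOf H) → COrder H, Function.Injective F ∧
      ((∀ a ∈ H, ∀ b ∈ H, a * b * a⁻¹ * b⁻¹ ∈ N) →
        (∀ o : LeftOrder H, o.IsConradian → o.IsConvex (N.subgroupOf H)) →
        Function.Surjective F) := by
  have hk : (Subgroup.inclusion hle).range = (QuotientGroup.mk' (N.subgroupOf H)).ker := by
    rw [QuotientGroup.ker_mk', Subgroup.inclusion_range]
  refine ⟨COrder.lex (Subgroup.inclusion_injective hle) hk,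
    COrder.lex_injective _ (QuotientGroup.mk'_surjective _) hk, fun hcomm hconv =>
    COrder.lex_surjective _ (QuotientGroup.mk'_surjective _) hk
      (Subgroup.quotient_mul_comm hcomm) fun o ho => ?_⟩
  rw [QuotientGroup.ker_mk']
  exact hconv o ho

theorem COrderable.subgroup {H N : Subgroup G} (hle : N ≤ H) (h : COrderable H) :
    COrderable N := by
  obtain ⟨o⟩ := h
  exact ⟨⟨o.1.comap _ (Subgroup.inclusion_injective hle), o.2.comap _ _⟩⟩

/-- The inductive step of the direct implication. Properness of the isolator comes from a maximal
convex subgroup; rank one and the drop in the count come from the injection of pairs of orders, the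
quotient contributing a factor 2. -/
theorem isRankOneSection_commutatorIsolator {H : Subgroup G} (hH : H ≠ ⊥) (ho : COrderable H)
    [Finite (COrder H)] : IsRankOneSection H H.commutatorIsolator ∧
      Finite (COrder H.commutatorIsolator) ∧
      Nat.card (COrder H.commutatorIsolator) < Nat.card (COrder H) := by
  have hle := H.commutatorIsolator_le
  have hnormal : (H.commutatorIsolator.subgroupOf H).Normal :=
    Subgroup.subgroupOf_normal_of_commutator_mem
      fun a ha b hb => Subgroup.commutator_mem_commutatorIsolator ha hb
  obtain ⟨F, hF, -⟩ := COrder.exists_lex_injective hle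
  have hoI : COrderable H.commutatorIsolator := ho.subgroup hle
  have hfin : Finite (COrder H.commutatorIsolator × COrder (H ⧸ H.commutatorIsolator.subgroupOf H)) :=
    Finite.of_injective F hF
  have hne : ∃ a ∈ H, a ∉ H.commutatorIsolator := by
    have : Nontrivial H := (Subgroup.nontrivial_iff_ne_bot H).2 hH
    obtain ⟨C, hC, hcomm, hroot⟩ := exists_ne_top_commutator_mem ho
    obtain ⟨a, ha⟩ : ∃ a : H, a ∉ C := by
      by_contra! h
      exact hC ((Subgroup.eq_top_iff' C).2 h)
    refine ⟨a, a.2, fun h => ha ?_⟩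
    obtain ⟨-, n, hn, h⟩ := Subgroup.mem_commutatorIsolator.1 h
    rw [← Subgroup.map_subtype_commutator] at h
    obtain ⟨y, hy, hya⟩ := h
    rw [show y = a ^ n from Subtype.ext hya] at hy
    exact hroot a n hn ((Subgroup.commutator_le.2 fun a _ b _ => hcomm a b) hy)
  have htf : ∀ (a : H ⧸ H.commutatorIsolator.subgroupOf H) (n : ℕ), n ≠ 0 → a ^ n = 1 → a = 1 := by
    intro a n hn h
    induction a using QuotientGroup.induction_on with
    | H a =>
      rw [← QuotientGroup.mk_pow, QuotientGroup.eq_one_iff, Subgroup.mem_subgroupOf] at h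
      rw [QuotientGroup.eq_one_iff, Subgroup.mem_subgroupOf]
      exact Subgroup.mem_commutatorIsolator_of_pow a.2 hn h
  have hcomm : ∀ a b : H ⧸ H.commutatorIsolator.subgroupOf H, a * b = b * a :=
    Subgroup.quotient_mul_comm fun a ha b hb => Subgroup.commutator_mem_commutatorIsolator ha hb
  have hoQ := cOrderable_of_torsionFree hcomm htf
  have : Nonempty (COrder H.commutatorIsolator) := hoI
  have : Nonempty (COrder (H ⧸ H.commutatorIsolator.subgroupOf H)) := hoQ
  have hfI : Finite (COrder H.commutatorIsolator) := Finite.prod_left (COrder (H ⧸ H.commutatorIsolator.subgroupOf H))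
  have hfQ : Finite (COrder (H ⧸ H.commutatorIsolator.subgroupOf H)) := Finite.prod_right (COrder H.commutatorIsolator)
  have hrank : IsRankOneGroup (H ⧸ H.commutatorIsolator.subgroupOf H) := by
    refine isRankOneGroup_of_finite hcomm htf ?_
    obtain ⟨a, ha, haI⟩ := hne
    refine ⟨((⟨a, ha⟩ : H) : H ⧸ H.commutatorIsolator.subgroupOf H), fun h => haI ?_⟩
    rwa [QuotientGroup.eq_one_iff, Subgroup.mem_subgroupOf] at h
  refine ⟨(isRankOneGroup_quotient_iff _ _).1 hrank, hfI, ?_⟩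
  have hcard := Nat.card_le_card_of_injective F hF
  rw [Nat.card_prod, hrank.card_cOrder] at hcard
  have hpos : 0 < Nat.card (COrder H.commutatorIsolator) := Nat.card_pos
  omega

/-- An element of N outside the isolator would be dependent, modulo the isolator, on an element `a`
outside N; then a nontrivial power of `a`, and so `a` itself, would lie in N. -/
theorem eq_commutatorIsolator_of_isRankOneSection {H N : Subgroup G} (ho : COrderable H)
    [Finite (COrder H)] (hle : N ≤ H) (h : IsRankOneSection H N) : N = H.commutatorIsolator := by
  refine le_antisymm (fun x hx => ?_) h.commutatorIsolator_le
  obtain ⟨a, ha, haN⟩ := h.exists_notMem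
  have hH : H ≠ ⊥ := by
    rintro rfl
    rw [Subgroup.mem_bot] at ha
    exact haN (ha ▸ one_mem N)
  obtain ⟨hI, -, -⟩ := isRankOneSection_commutatorIsolator hH ho
  by_contra hxI
  obtain ⟨m, n, -, hn, hmn⟩ := hI.exists_zpow x (hle hx) a ha hxI
    fun haI => haN (h.commutatorIsolator_le haI)
  have han : a ^ n ∈ N :=
    (Subgroup.mul_mem_cancel_left N (zpow_mem hx m)).1 (h.commutatorIsolator_le hmn)
  refine haN (h.mem_of_pow a ha n.natAbs (Int.natAbs_ne_zero.2 hn) ?_)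
  rcases Int.natAbs_eq n with h1 | h1
  · rw [h1, zpow_natCast] at han; exact han
  · rw [h1, zpow_neg, zpow_natCast] at han; exact inv_mem_iff.1 han

end Isolator

/-! ### Convexity of the terms of a rational series -/

section Convexity

variable {G : Type*} [Group G]

theorem Subgroup.commutator_mem_of_quotient_mul_comm {H N : Subgroup G}
    [(N.subgroupOf H).Normal] (h : ∀ a b : H ⧸ N.subgroupOf H, a * b = b * a) :
    ∀ a ∈ H, ∀ b ∈ H, a * b * a⁻¹ * b⁻¹ ∈ N := by
  intro a ha b hb
  have : ((⟨a, ha⟩ * ⟨b, hb⟩ * ⟨a, ha⟩⁻¹ * ⟨b, hb⟩⁻¹ : H) : H ⧸ N.subgroupOf H) = 1 := by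
    simp only [QuotientGroup.mk_mul, QuotientGroup.mk_inv]
    rw [h (⟨a, ha⟩ : H), mul_inv_cancel_right, mul_inv_cancel]
  rwa [QuotientGroup.eq_one_iff, Subgroup.mem_subgroupOf] at this

theorem Subgroup.zpow_natAbs_mem {C : Subgroup G} {g : G} {n : ℤ} (h : g ^ n ∈ C) :
    g ^ n.natAbs ∈ C := by
  rcases Int.natAbs_eq n with h1 | h1
  · rw [h1, zpow_natCast] at h; exact h
  · rw [h1, zpow_neg, zpow_natCast] at h; exact inv_mem_iff.1 h

theorem LeftOrder.IsConvex.mem_of_zpow_mem {o : LeftOrder G} {C : Subgroup G}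
    (hC : o.IsConvex C) {g : G} {n : ℤ} (hn : n ≠ 0) (h : g ^ n ∈ C) : g ∈ C :=
  hC.mem_of_pow_mem (Int.natAbs_ne_zero.2 hn) (Subgroup.zpow_natAbs_mem h)

theorem IsRankOneSection.subgroupOf {H A B : Subgroup G} (h : IsRankOneSection A B) (hA : A ≤ H) :
    IsRankOneSection (A.subgroupOf H) (B.subgroupOf H) where
  commutator_mem a ha b hb := h.commutator_mem a ha b hb
  mem_of_pow a ha n hn hmem := h.mem_of_pow a ha n hn hmem
  exists_notMem := by
    obtain ⟨a, ha, haB⟩ := h.exists_notMem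
    exact ⟨⟨a, hA ha⟩, ha, haB⟩
  exists_zpow a ha b hb haB hbB := by
    obtain ⟨m, n, hm, hn, hmn⟩ := h.exists_zpow a ha b hb haB hbB
    exact ⟨m, n, hm, hn, hmn⟩

/-! ### Convexity forced by a noncommutative double quotient -/

namespace LeftOrder

variable {o : LeftOrder G}

/-- The largest convex subgroup avoiding a given nontrivial element. -/
def convexAvoiding (o : LeftOrder G) {b : G} (hb : b ≠ 1) : Subgroup G where
  carrier := {x | ∃ E : Subgroup G, o.IsConvex E ∧ b ∉ E ∧ x ∈ E}
  one_mem' := ⟨⊥, o.isConvex_bot, by simpa using hb, one_mem _⟩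
  inv_mem' := by
    rintro x ⟨E, hE, hbE, hx⟩
    exact ⟨E, hE, hbE, inv_mem hx⟩
  mul_mem' := by
    rintro x y ⟨E, hE, hbE, hx⟩ ⟨F, hF, hbF, hy⟩
    rcases hE.le_total hF with h | h
    · exact ⟨F, hF, hbF, mul_mem (h hx) hy⟩
    · exact ⟨E, hE, hbE, mul_mem hx (h hy)⟩

theorem isConvex_convexAvoiding (o : LeftOrder G) {b : G} (hb : b ≠ 1) :
    o.IsConvex (o.convexAvoiding hb) := by
  rintro x y hx hxy ⟨E, hE, hbE, hy⟩
  exact ⟨E, hE, hbE, hE x y hx hxy hy⟩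

theorem IsConvex.le_convexAvoiding {E : Subgroup G} (hE : o.IsConvex E) {b : G} (hb : b ≠ 1)
    (hbE : b ∉ E) : E ≤ o.convexAvoiding hb := fun _ hx => ⟨E, hE, hbE, hx⟩

theorem notMem_convexAvoiding (o : LeftOrder G) {b : G} (hb : b ≠ 1) :
    b ∉ o.convexAvoiding hb := by
  rintro ⟨E, -, hbE, h⟩
  exact hbE h

/-- In a Conradian order, a normal subgroup `N` is convex as soon as it sits in a chain
`G ▹ N ▹ L` of rank-one sections with `L` relatively convex in `N` and noncommutative `G / L`. -/
theorem IsConradian.isConvex_of_isRankOneSection (ho : o.IsConradian) {N L : Subgroup G}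
    (hGN : IsRankOneSection ⊤ N) (hNL : IsRankOneSection N L)
    (hL : ∀ x y : G, o.le 1 x → o.le x y → x ∈ N → y ∈ L → x ∈ L)
    (hnc : ¬ ∀ a b : G, a * b * a⁻¹ * b⁻¹ ∈ L) : o.IsConvex N := by
  obtain ⟨b, hbN, hbL, hb⟩ : ∃ b, b ∈ N ∧ b ∉ L ∧ b ∈ o.cone := by
    obtain ⟨b, hbN, hbL⟩ := hNL.exists_notMem
    rcases o.mem_cone_or b with hb | hb
    · exact ⟨b, hbN, hbL, hb⟩
    · exact ⟨b⁻¹, inv_mem hbN, by simpa using hbL, hb⟩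
  have hb1 : b ≠ 1 := fun h => hbL (h ▸ one_mem L)
  obtain ⟨D, hD, hmem⟩ := exists_isConvex_of_mem_cone ho hb hb1
  have hbD : b ∈ D := (hmem b).2 ⟨1, by rw [pow_one]; exact o.le_refl b, by
    rw [le_iff_mem_cone]; simpa using o.mul_mem_cone hb hb⟩
  -- Relative convexity of `L` puts a positive element of `N` outside `L` above all of `L`.
  have hLpos : ∀ (E : Subgroup G) (x : G), o.IsConvex E → x ∈ E → x ∈ N → x ∉ L → x ∈ o.cone →
      L ≤ E := by
    intro E x hE hxE hxN hxL hx
    have pos : ∀ y ∈ L, y ∈ o.cone → y ∈ E := by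
      intro y hy hyc
      rcases o.le_total y x with h | h
      · exact hE y x hyc h hxE
      · exact absurd (hL x y hx h hxN hy) hxL
    intro y hy
    rcases o.mem_cone_or y with h | h
    · exact pos y hy h
    · exact inv_mem_iff.1 (pos _ (inv_mem hy) h)
  have hLD : L ≤ D := hLpos D b hD hbD hbN hbL hb
  have hND : N ≤ D := by
    intro x hx
    by_cases hxL : x ∈ L
    · exact hLD hxL
    · obtain ⟨m, n, hm, -, hmn⟩ := hNL.exists_zpow x hx b hbN hxL hbL
      exact hD.mem_of_zpow_mem hm
        ((Subgroup.mul_mem_cancel_right D (zpow_mem hbD n)).1 (hLD hmn))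
  by_cases hDN : D ≤ N
  · rwa [_root_.le_antisymm hND hDN]
  exfalso
  obtain ⟨c, hcD, hcN⟩ := SetLike.not_le_iff_exists.1 hDN
  have hDtop : D = ⊤ := by
    refine (Subgroup.eq_top_iff' D).2 fun g => ?_
    by_cases hgN : g ∈ N
    · exact hND hgN
    · obtain ⟨m, n, hm, -, hmn⟩ := hGN.exists_zpow g trivial c trivial hgN hcN
      exact hD.mem_of_zpow_mem hm
        ((Subgroup.mul_mem_cancel_right D (zpow_mem hcD n)).1 (hND hmn))
  -- The hull of `b` is now the whole group, so the largest convex subgroup avoiding `b` is maximal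
  -- and contains all commutators.
  have hC := o.isConvex_convexAvoiding hb1
  have hcomm := hC.commutator_mem ho fun E hE => by
    by_cases hbE : b ∈ E
    · right
      rw [eq_top_iff, ← hDtop]
      intro x hx
      obtain ⟨n, h1, h2⟩ := (hmem x).1 hx
      rcases o.mem_cone_or x with h | h
      · exact hE x _ h h1 (pow_mem hbE n)
      · exact inv_mem_iff.1 (hE _ _ h h2 (pow_mem hbE n))
    · exact Or.inl (hE.le_convexAvoiding hb1 hbE)
  -- This subgroup meets `N` inside `L`: otherwise it would contain `L` and then, by rank one, a
  -- power of `b`. Commutators lie in both, hence in `L`, a contradiction.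
  have pos : ∀ x ∈ o.convexAvoiding hb1, x ∈ N → x ∈ o.cone → x ∈ L := by
    intro x hxC hxN hx
    by_contra hxL
    have hLC := hLpos _ x hC hxC hxN hxL hx
    obtain ⟨m, n, -, hn, hmn⟩ := hNL.exists_zpow x hxN b hbN hxL hbL
    exact o.notMem_convexAvoiding hb1 (hC.mem_of_zpow_mem hn
      ((Subgroup.mul_mem_cancel_left _ (zpow_mem hxC m)).1 (hLC hmn)))
  refine hnc fun x y => ?_
  have h1 := hcomm x y
  have h2 := hGN.commutator_mem x trivial y trivial
  rcases o.mem_cone_or (x * y * x⁻¹ * y⁻¹) with h | h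
  · exact pos _ h1 h2 h
  · exact inv_mem_iff.1 (pos _ (inv_mem h1) (inv_mem h2) h)

theorem le_comap_iff {H : Type*} [Group H] {i : H →* G} {hi : Function.Injective i} {a b : H} :
    (o.comap i hi).le a b ↔ o.le (i a) (i b) := by
  rw [le_iff_mem_cone, le_iff_mem_cone, mem_cone_comap, map_mul, map_inv]

end LeftOrder

/-- In a chain of rank-one sections without commutative double quotients, every term is convex in
the preceding one, for all Conradian orders. -/
theorem isConvex_of_chain {S : ℕ → Subgroup G} {k : ℕ} (hbot : S k = ⊥)
    (hle : ∀ i < k, S (i + 1) ≤ S i) (hsec : ∀ i < k, IsRankOneSection (S i) (S (i + 1)))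
    (hnc : ∀ i, i + 2 ≤ k → ¬ ∀ a ∈ S i, ∀ b ∈ S i, a * b * a⁻¹ * b⁻¹ ∈ S (i + 2)) :
    ∀ (d i : ℕ), i + 1 + d = k → ∀ o : LeftOrder (S i), o.IsConradian →
      o.IsConvex ((S (i + 1)).subgroupOf (S i)) := by
  -- Induction from the bottom of the chain: `d` counts the steps below `S (i + 1)`.
  intro d
  induction d with
  | zero =>
    intro i hi o _
    rw [show i + 1 = k from hi, hbot, Subgroup.bot_subgroupOf]
    exact o.isConvex_bot
  | succ d ih =>
    intro i hi o ho
    have hle1 := hle i (by omega)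
    have hle2 := hle (i + 1) (by omega)
    have h1 := (hsec i (by omega)).subgroupOf le_rfl
    rw [Subgroup.subgroupOf_self] at h1
    refine ho.isConvex_of_isRankOneSection h1 ((hsec (i + 1) (by omega)).subgroupOf hle1) ?_ ?_
    · intro x y hx hxy hxN hyL
      have hinj := Subgroup.inclusion_injective hle1
      have := ih (i + 1) (by omega) (o.comap _ hinj) (ho.comap _ hinj) ⟨x, hxN⟩ ⟨y, hle2 hyL⟩
        (LeftOrder.le_comap_iff.2 (by rw [map_one]; exact hx)) (LeftOrder.le_comap_iff.2 hxy) hyL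
      exact this
    · intro h
      exact hnc i (by omega) fun a ha b hb => h ⟨a, ha⟩ ⟨b, hb⟩

theorem card_cOrder_of_subsingleton {H : Type*} [Group H] [Subsingleton H] :
    Nat.card (COrder H) = 1 := by
  rw [Nat.card_eq_one_iff_unique]
  refine ⟨⟨fun a b => Subtype.ext (LeftOrder.eq_of_cone_subset fun x _ => ?_)⟩,
    cOrderable_of_torsionFree (fun _ _ => Subsingleton.elim _ _) fun _ _ _ _ =>
      Subsingleton.elim _ _⟩
  rw [Subsingleton.elim x 1]
  exact b.1.one_mem_cone

/-- Convexity for all `C`-orders makes the lexicographic map bijective, so each rank-one quotient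
contributes a factor 2. -/
theorem card_cOrder_of_chain {S : ℕ → Subgroup G} {k : ℕ} (hbot : S k = ⊥)
    (hle : ∀ i < k, S (i + 1) ≤ S i) (hsec : ∀ i < k, IsRankOneSection (S i) (S (i + 1)))
    (hnc : ∀ i, i + 2 ≤ k → ¬ ∀ a ∈ S i, ∀ b ∈ S i, a * b * a⁻¹ * b⁻¹ ∈ S (i + 2)) :
    ∀ (d i : ℕ), i + d = k → Nat.card (COrder (S i)) = 2 ^ d := by
  intro d
  induction d with
  | zero =>
    intro i hi
    rw [show i = k from hi, hbot]
    exact card_cOrder_of_subsingleton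
  | succ d ih =>
    intro i hi
    have hs := hsec i (by omega)
    have := Subgroup.subgroupOf_normal_of_commutator_mem hs.commutator_mem
    obtain ⟨F, hF, hF'⟩ := COrder.exists_lex_injective (hle i (by omega))
    have hbij : Function.Bijective F := ⟨hF, hF' hs.commutator_mem
      (isConvex_of_chain hbot hle hsec hnc d i (by omega))⟩
    rw [← Nat.card_eq_of_bijective F hbij, Nat.card_prod, ih (i + 1) (by omega),
      ((isRankOneGroup_quotient_iff _ _).2 hs).card_cOrder, pow_succ]

/-- Transport of `C`-orders along an isomorphism. -/
def COrder.congr {H : Type*} [Group H] (e : G ≃* H) : COrder G ≃ COrder H where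
  toFun o := ⟨o.1.comap e.symm.toMonoidHom e.symm.injective, o.2.comap _ _⟩
  invFun o := ⟨o.1.comap e.toMonoidHom e.injective, o.2.comap _ _⟩
  left_inv o := Subtype.ext (LeftOrder.eq_of_cone_subset fun x hx => by
    simpa [LeftOrder.mem_cone_comap] using hx)
  right_inv o := Subtype.ext (LeftOrder.eq_of_cone_subset fun x hx => by
    simpa [LeftOrder.mem_cone_comap] using hx)

end Convexity

/-! ### Rational series -/

namespace RationalSeries

variable {G : Type*} [Group G]

theorem isRankOneSection (s : RationalSeries G) (i : Fin s.length) :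
    IsRankOneSection (s.subgroup i.castSucc) (s.subgroup i.succ) := by
  have := s.succ_normal i
  exact (isRankOneGroup_quotient_iff _ _).1 (isTorsionFreeRankOneAbelian_iff.1 (s.quotient_rankOne i))

theorem eq_of_subgroup_eq {s t : RationalSeries G} (hlen : s.length = t.length)
    (h : ∀ (i : ℕ) (hs : i < s.length + 1) (ht : i < t.length + 1),
      s.subgroup ⟨i, hs⟩ = t.subgroup ⟨i, ht⟩) : s = t := by
  obtain ⟨n, f, _, _, _, _, _⟩ := s
  obtain ⟨m, g, _, _, _, _, _⟩ := t
  obtain rfl : n = m := hlen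
  obtain rfl : f = g := funext fun i => h i i.2 i.2
  rfl

theorem card_cOrder (s : RationalSeries G) (hs : s.IsNormal)
    (hnc : s.NoAbelianDoubleQuotient hs) : Nat.card (COrder G) = 2 ^ s.length := by
  -- Indexing by `ℕ` avoids `Fin` arithmetic; only values in range are used.
  let S : ℕ → Subgroup G := fun n => if h : n < s.length + 1 then s.subgroup ⟨n, h⟩ else ⊥
  have hS : ∀ (n : ℕ) (h : n < s.length + 1), S n = s.subgroup ⟨n, h⟩ := fun n h => dif_pos h
  have h0 : S 0 = ⊤ := (hS 0 (by omega)).trans s.subgroup_zero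
  have hk : S s.length = ⊥ := (hS s.length (by omega)).trans s.subgroup_last
  have key := card_cOrder_of_chain hk
    (fun i hi => by
      rw [hS i (by omega), hS (i + 1) (by omega)]; exact s.succ_le ⟨i, hi⟩)
    (fun i hi => by
      rw [hS i (by omega), hS (i + 1) (by omega)]; exact s.isRankOneSection ⟨i, hi⟩)
    (fun i hi h => by
      rw [hS i (by omega), hS (i + 2) (by omega)] at h
      have := hs ⟨i + 2, by omega⟩
      exact hnc ⟨i, by omega⟩ ⟨i + 2, by omega⟩ rfl (Subgroup.quotient_mul_comm h))
    s.length 0 (zero_add _)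
  rw [← key, h0]
  exact Nat.card_congr (COrder.congr Subgroup.topEquiv.symm)

/-- The iterated isolators of the commutator subgroups. -/
def iteratedIsolator (G : Type*) [Group G] (n : ℕ) : Subgroup G :=
  Subgroup.commutatorIsolator^[n] ⊤

theorem iteratedIsolator_succ (n : ℕ) :
    iteratedIsolator G (n + 1) = (iteratedIsolator G n).commutatorIsolator :=
  Function.iterate_succ_apply' ..

theorem iteratedIsolator_normal (n : ℕ) : (iteratedIsolator G n).Normal := by
  induction n with
  | zero => exact inferInstanceAs (⊤ : Subgroup G).Normal
  | succ n ih => rw [iteratedIsolator_succ]; exact Subgroup.commutatorIsolator_normal _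

theorem cOrderable_iteratedIsolator (ho : COrderable G) [Finite (COrder G)] (n : ℕ) :
    COrderable (iteratedIsolator G n) ∧ Finite (COrder (iteratedIsolator G n)) := by
  induction n with
  | zero =>
    have e : COrder G ≃ COrder (iteratedIsolator G 0) := COrder.congr Subgroup.topEquiv.symm
    exact ⟨ho.map e, Finite.of_equiv _ e⟩
  | succ n ih =>
    obtain ⟨ih1, ih2⟩ := ih
    rw [iteratedIsolator_succ]
    refine ⟨ih1.subgroup (Subgroup.commutatorIsolator_le _), ?_⟩
    by_cases h : iteratedIsolator G n = ⊥
    · have : (iteratedIsolator G n).commutatorIsolator = iteratedIsolator G n :=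
        le_antisymm (Subgroup.commutatorIsolator_le _) (by rw [h]; exact bot_le)
      rw [this]; exact ih2
    · exact (isRankOneSection_commutatorIsolator h ih1).2.1

/-- The number of `C`-orders drops strictly while the terms are nontrivial. -/
theorem exists_iteratedIsolator_eq_bot (ho : COrderable G) [Finite (COrder G)] :
    ∃ n, iteratedIsolator G n = ⊥ := by
  by_contra! h
  have key : ∀ n, Nat.card (COrder (iteratedIsolator G n)) + n ≤
      Nat.card (COrder (iteratedIsolator G 0)) := by
    intro n
    induction n with
    | zero => exact le_rfl
    | succ n ih =>
      obtain ⟨h1, h2⟩ := cOrderable_iteratedIsolator ho n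
      have := (isRankOneSection_commutatorIsolator (h n) h1).2.2
      rw [← iteratedIsolator_succ] at this
      omega
  have h1 := key (Nat.card (COrder (iteratedIsolator G 0)) + 1)
  omega

theorem exists_unique_of_finite (ho : COrderable G) [Finite (COrder G)] :
    ∃ s : RationalSeries G, (∀ t : RationalSeries G, t = s) ∧
      ∃ hs : s.IsNormal, s.NoAbelianDoubleQuotient hs := by
  classical
  have hex := exists_iteratedIsolator_eq_bot ho
  have hsec : ∀ i < Nat.find hex,
      IsRankOneSection (iteratedIsolator G i) (iteratedIsolator G (i + 1)) := by
    intro i hi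
    obtain ⟨h1, h2⟩ := cOrderable_iteratedIsolator ho i
    rw [iteratedIsolator_succ]
    exact (isRankOneSection_commutatorIsolator (Nat.find_min hex hi) h1).1
  have hnormal : ∀ i : Fin (Nat.find hex), ((iteratedIsolator G (i.succ : ℕ)).subgroupOf
      (iteratedIsolator G (i.castSucc : ℕ))).Normal := fun i =>
    Subgroup.subgroupOf_normal_of_commutator_mem (hsec i i.2).commutator_mem
  let s : RationalSeries G :=
    { length := Nat.find hex
      subgroup := fun i => iteratedIsolator G i
      subgroup_zero := rfl
      subgroup_last := Nat.find_spec hex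
      succ_le := fun i => by
        rw [Fin.val_succ, iteratedIsolator_succ]
        exact Subgroup.commutatorIsolator_le _
      succ_normal := hnormal
      quotient_rankOne := fun i => by
        have := hnormal i
        exact isTorsionFreeRankOneAbelian_iff.2 ((isRankOneGroup_quotient_iff _ _).2 (hsec i i.2)) }
  refine ⟨s, fun t => ?_, fun i => iteratedIsolator_normal _, ?_⟩
  · have hterm : ∀ (i : ℕ) (hi : i < t.length + 1), t.subgroup ⟨i, hi⟩ = iteratedIsolator G i := by
      intro i
      induction i with
      | zero => intro _; exact t.subgroup_zero
      | succ i ih =>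
        intro hi
        have h1 : t.subgroup (Fin.castSucc ⟨i, by omega⟩) = iteratedIsolator G i := ih (by omega)
        have h2 := t.isRankOneSection ⟨i, by omega⟩
        have h3 := t.succ_le ⟨i, by omega⟩
        rw [h1] at h2 h3
        obtain ⟨h4, h5⟩ := cOrderable_iteratedIsolator ho i
        rw [iteratedIsolator_succ]
        exact eq_commutatorIsolator_of_isRankOneSection h4 h3 h2
    have hlen : t.length = Nat.find hex := by
      refine le_antisymm ?_ (Nat.find_min' hex ?_)
      -- A longer series would have a nontrivial section with trivial upper term.
      · by_contra! hlt
        obtain ⟨a, ha, ha'⟩ := (t.isRankOneSection ⟨Nat.find hex, hlt⟩).exists_notMem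
        have h1 : t.subgroup (Fin.castSucc ⟨Nat.find hex, hlt⟩) = ⊥ :=
          (hterm _ (by omega)).trans (Nat.find_spec hex)
        rw [h1, Subgroup.mem_bot] at ha
        exact ha' (ha ▸ one_mem _)
      · rw [← hterm t.length (by omega)]
        exact t.subgroup_last
    exact eq_of_subgroup_eq hlen fun i h1 _ => hterm i h1
  · intro i j hij hcomm
    have hj : (j : ℕ) < Nat.find hex + 1 := j.2
    have : ((iteratedIsolator G (j : ℕ)).subgroupOf (iteratedIsolator G (i : ℕ))).Normal :=
      (iteratedIsolator_normal _).subgroupOf _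
    have h1 := Subgroup.commutator_mem_of_quotient_mul_comm
      (H := iteratedIsolator G (i : ℕ)) (N := iteratedIsolator G (j : ℕ)) hcomm
    rw [← hij] at h1
    -- An element of the middle term has a power in the commutator subgroup of the upper one, hence
    -- in the lower term; torsion-freeness puts the element itself there.
    have h2 := hsec (i + 1) (by omega)
    obtain ⟨a, ha, ha'⟩ := h2.exists_notMem
    have ha2 := ha
    rw [iteratedIsolator_succ] at ha2
    obtain ⟨-, n, hn, han⟩ := Subgroup.mem_commutatorIsolator.1 ha2
    exact ha' (h2.mem_of_pow a ha n hn
      ((Subgroup.commutator_le.2 fun a ha b hb => h1 a ha b hb) han))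

end RationalSeries

theorem mainTheorem6 {G : Type*} [Group G] :
    (COrderable G → Finite (COrder G) →
      ∃ s : RationalSeries G, (∀ t : RationalSeries G, t = s) ∧
        ∃ hs : s.IsNormal, s.NoAbelianDoubleQuotient hs) ∧
    (∀ (s : RationalSeries G) (hs : s.IsNormal), s.NoAbelianDoubleQuotient hs →
      Nat.card (COrder G) = 2 ^ s.length) :=
  ⟨fun ho _ => RationalSeries.exists_unique_of_finite ho,
    fun s hs hnc => s.card_cOrder hs hnc⟩
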